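/- There are absolute constants $c,e,\Delta\in\mathbb N$ such that the following holds for every field $\mathbb K$ and all $d_1,d_2\in\mathbb N$ with $|\mathbb K|\ge (d_1d_2)^c$. An algebraic circuit over $\mathbb K$ is a directed acyclic graph whose leaves are variables or constants of $\mathbb K$ and whose other gates are sums and products of unbounded fan-in; its size is the number of its gates and wires, and its depth is the length of a longest path in it. There are families $(A_k)_{0\le k\le d_1}$, $(B_k)_{0\le k\le d_1}$, $(T_k)_{0\le k\le d_1}$ of algebraic circuits over $\mathbb K$ (depending only on $\mathbb K,d_1,d_2$), each of size at most $(d_1+d_2+2)^e$ and depth at most $\Delta$, which take as input the coefficient vectors of two polynomials; $B_k$ and $T_k$ have one output, and $A_k$ has $d_1+1$ outputs, read as the coefficients of a polynomial in $\mathbb K[y]$. For every pair of monic polynomials $f,g\in\mathbb K[y]$ with $\deg f=d_1$ and $\deg g=d_2$, they satisfy the following, where $\Sigma$ is the multiset of roots of $f$ in the algebraic closure $\overline{\mathbb K}$, $\mathrm{Esym}_k$ is the $k$-th elementary symmetric polynomial, and each circuit is evaluated at the coefficients of $f$ and $g$. 1. For every $0\le k\le d_1$, $$T_k=B_k=\mathrm{Esym}_k\big(\{g(\sigma):\sigma\in\Sigma\}\big),\qquad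 A_k=\mathrm{Esym}_k\big(\{(y-\sigma)\,g(\sigma):\sigma\in\Sigma\}\big).$$ 2. The maximum $r=\max\{k\le d_1: T_k\ne 0\}$ exists, $B_r\neq 0$, and $$\mathrm{Filter}(f\mid g\neq 0)=\frac{A_r}{B_r},$$ where, for $f=\prod_{i=1}^m (y-\sigma_i)^{e_i}$ with distinct $\sigma_i\in\overline{\mathbb K}$ and $e_i\ge 1$, $\mathrm{Filter}(f\mid g\ne 0)=\prod_{i\in[m],\ g(\sigma_i)\ne 0}(y-\sigma_i)^{e_i}$. -/

import Mathlib

open Polynomial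

/-- A gate of an algebraic circuit over `K` with variables indexed by `V`, placed after `n` earlier
gates: a variable, a constant of `K`, or a sum or product gate of unbounded fan-in whose children
are earlier gates (repetitions are parallel wires). -/
inductive CircuitGate (K V : Type*) (n : ℕ) where
  | var (v : V)
  | const (a : K)
  | add (children : List (Fin n))
  | mul (children : List (Fin n))

/-- The number of wires that enter a gate. -/
def CircuitGate.fanIn {K V : Type*} {n : ℕ} : CircuitGate K V n → ℕ
  | .var _ => 0
  | .const _ => 0
  | .add l => l.length
  | .mul l => l.length

/-- An algebraic circuit over `K` with variables indexed by `V` and `m` outputs: a directed acyclic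
graph of gates, listed in a topological order. -/
structure AlgCircuit (K V : Type*) (m : ℕ) where
  numGates : ℕ
  gate : (i : Fin numGates) → CircuitGate K V i
  output : Fin m → Fin numGates

namespace AlgCircuit

variable {K V : Type*} {m : ℕ}

/-- The size: number of gates plus number of wires. -/
def size (C : AlgCircuit K V m) : ℕ :=
  C.numGates + ∑ i, (C.gate i).fanIn

/-- The depth of a gate: the length of a longest path from a leaf to it
(a sum or product gate without children has depth `1`). -/
def gateDepth (C : AlgCircuit K V m) (i : Fin C.numGates) : ℕ :=
  match C.gate i with
  | .var _ => 0
  | .const _ => 0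
  | .add l => (l.map fun j : Fin i.val => C.gateDepth ⟨j, j.2.trans i.2⟩).foldr max 0 + 1
  | .mul l => (l.map fun j : Fin i.val => C.gateDepth ⟨j, j.2.trans i.2⟩).foldr max 0 + 1
termination_by i.val
decreasing_by all_goals exact j.2

/-- The depth of a circuit: the largest depth of a gate. -/
def depth (C : AlgCircuit K V m) : ℕ :=
  Finset.univ.sup C.gateDepth

/-- The value of a gate when the variables take the values `x`. -/
def gateValue [CommSemiring K] (C : AlgCircuit K V m) (x : V → K) (i : Fin C.numGates) : K :=
  match C.gate i with
  | .var v => x v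
  | .const a => a
  | .add l => (l.map fun j : Fin i.val => C.gateValue x ⟨j, j.2.trans i.2⟩).sum
  | .mul l => (l.map fun j : Fin i.val => C.gateValue x ⟨j, j.2.trans i.2⟩).prod
termination_by i.val
decreasing_by all_goals exact j.2

/-- The vector of outputs of a circuit when the variables take the values `x`. -/
def eval [CommSemiring K] (C : AlgCircuit K V m) (x : V → K) : Fin m → K :=
  fun i => C.gateValue x (C.output i)

end AlgCircuit

/-- The coefficient vectors of `f` (degree at most `d₁`) and `g` (degree at most `d₂`),
side by side. -/
def coeffVec {K : Type*} [Semiring K] (d₁ d₂ : ℕ) (f g : K[X]) : Fin (d₁ + 1) ⊕ Fin (d₂ + 1) → K :=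
  Sum.elim (fun i => f.coeff i) (fun j => g.coeff j)

/-- The polynomial with coefficient vector `a`. -/
noncomputable def polyOfVec {K : Type*} [Semiring K] {m : ℕ} (a : Fin m → K) : K[X] :=
  ∑ i, C (a i) * X ^ (i : ℕ)

open Classical in
/-- `Filter(f ∣ g ≠ 0)`: the product of the factors `(y - σ) ^ e` of `f` over the roots `σ` of `f`
in the algebraic closure with `g(σ) ≠ 0`, where `e` is the multiplicity of `σ` in `f`. -/
noncomputable def filterNe {K : Type*} [Field K] (f g : K[X]) : (AlgebraicClosure K)[X] :=
  ∏ σ ∈ (f.aroots (AlgebraicClosure K)).toFinset with aeval σ g ≠ 0,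
    (X - C σ) ^ (f.aroots (AlgebraicClosure K)).count σ

/-! For monic f, the resultant in y of f and 1 + z g is ∏ (1 + z g(σ)), whose coefficients in z are
the elementary symmetric functions of the g(σ). Replacing g by (v - y) g gives those of the (v - σ)
g(σ) for each v in K. Coefficients are fixed linear combinations of values at distinct points of K,
so all that is needed is a constant-depth circuit for Res(f, G), f monic of degree n
(`Computes.resultant`).

Fix h = ∏ (X - α_i) with distinct α_i in K, put u = f - h and deform along h + t u. Modulo t^N this
polynomial splits with roots φ_i close to α_i, and its resultant with G is ∏ G(φ_i)
(`resultant_deformation_eq`). The difference φ_i - α_i solves z = t ψ(z) with ψ = -u / ∏_{j ≠ i} (X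
- α_j) expanded at α_i. For L(G) = ∑ t^m [z^m] (G ψ^m), a form of Lagrange inversion gives L(G) =
G(φ_i) L(1) (`lagrangeSum_coe`); no integer is divided by, so the characteristic is irrelevant, and
L(1) ≡ 1 mod t is inverted by a finite geometric series. Each [z^m] (G ψ^m) is linear in G u^m,
hence a combination of the values G(a) u(a)^m. As the resultant has degree below N in t, its value
at t = 1 is the sum of the first N coefficients of the product
(`resultant_eq_sum_coeff_lagrangeNorm`), which interpolation in t recovers.

For the filter (`exists_isGreatest_filterNe`): vanishing g(σ) contribute nothing, so the last
nonzero T_r is the product of the nonzero g(σ), and A_r is that product times the filter. The nodes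
required number at most (d₁ d₂)^8 unless d₁ d₂ ≤ 1; these degrees have direct circuits. -/

/-! ### Assembling circuits: juxtaposition and one extra gate. -/

/-- Relabelling of the children of a gate. -/
def CircuitGate.map {K V : Type*} {n n' : ℕ} (φ : Fin n → Fin n') :
    CircuitGate K V n → CircuitGate K V n'
  | .var v => .var v
  | .const a => .const a
  | .add l => .add (l.map φ)
  | .mul l => .mul (l.map φ)

theorem CircuitGate.fanIn_map {K V : Type*} {n n' : ℕ} (φ : Fin n → Fin n')
    (g : CircuitGate K V n) : (g.map φ).fanIn = g.fanIn := by
  cases g <;> simp [CircuitGate.map, CircuitGate.fanIn]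

namespace AlgCircuit

variable {K V : Type*} {m m₁ m₂ : ℕ}

/-- `φ` embeds the gates of `C` into those of `D`, respecting wires. -/
def IsEmbedding (C : AlgCircuit K V m₁) (D : AlgCircuit K V m₂)
    (φ : Fin C.numGates → Fin D.numGates) : Prop :=
  ∀ i, ∃ f : Fin i.val → Fin (φ i).val,
    (∀ j, (f j).val = (φ ⟨j, j.2.trans i.2⟩).val) ∧ D.gate (φ i) = (C.gate i).map f

/-- Depth depends only on the gates below a given one, and an embedding carries these along with
their wires; hence strong induction on the position. -/
theorem IsEmbedding.gateDepth_eq {C : AlgCircuit K V m₁} {D : AlgCircuit K V m₂}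
    {φ : Fin C.numGates → Fin D.numGates} (h : IsEmbedding C D φ) (i : Fin C.numGates) :
    D.gateDepth (φ i) = C.gateDepth i := by
  obtain ⟨k, hk⟩ := i
  induction k using Nat.strong_induction_on with
  | _ k ih =>
    obtain ⟨f, hf, hg⟩ := h ⟨k, hk⟩
    have key : ∀ j : Fin k, D.gateDepth ⟨f j, (f j).2.trans (φ ⟨k, hk⟩).2⟩ =
        C.gateDepth ⟨j, j.2.trans hk⟩ := by
      intro j
      rw [← ih j j.2 (j.2.trans hk)]
      congr 1
      exact Fin.ext (hf j)
    rw [gateDepth, gateDepth, hg]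
    cases C.gate ⟨k, hk⟩ with
    | var v => rfl
    | const a => rfl
    | add l =>
      simp only [CircuitGate.map, List.map_map]
      congr 3
      funext j
      exact key j
    | mul l =>
      simp only [CircuitGate.map, List.map_map]
      congr 3
      funext j
      exact key j

theorem IsEmbedding.gateValue_eq [CommSemiring K] {C : AlgCircuit K V m₁}
    {D : AlgCircuit K V m₂} {φ : Fin C.numGates → Fin D.numGates} (h : IsEmbedding C D φ)
    (x : V → K) (i : Fin C.numGates) :
    D.gateValue x (φ i) = C.gateValue x i := by
  obtain ⟨k, hk⟩ := i
  induction k using Nat.strong_induction_on with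
  | _ k ih =>
    obtain ⟨f, hf, hg⟩ := h ⟨k, hk⟩
    have key : ∀ j : Fin k, D.gateValue x ⟨f j, (f j).2.trans (φ ⟨k, hk⟩).2⟩ =
        C.gateValue x ⟨j, j.2.trans hk⟩ := by
      intro j
      rw [← ih j j.2 (j.2.trans hk)]
      congr 1
      exact Fin.ext (hf j)
    rw [gateValue, gateValue, hg]
    cases C.gate ⟨k, hk⟩ with
    | var v => rfl
    | const a => rfl
    | add l =>
      simp only [CircuitGate.map, List.map_map]
      congr 2
      funext j
      exact key j
    | mul l =>
      simp only [CircuitGate.map, List.map_map]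
      congr 2
      funext j
      exact key j

/-- Two circuits side by side. -/
def append (C : AlgCircuit K V m₁) (D : AlgCircuit K V m₂) : AlgCircuit K V (m₁ + m₂) where
  numGates := C.numGates + D.numGates
  gate i := if h : i.val < C.numGates then C.gate ⟨i, h⟩ else
    (D.gate ⟨i.val - C.numGates, by omega⟩).map
      fun j => ⟨j.val + C.numGates, by have := j.2; simp only at this; omega⟩
  output := Fin.append (fun i => (C.output i).castAdd _) fun i => (D.output i).natAdd _

theorem isEmbedding_append_left (C : AlgCircuit K V m₁) (D : AlgCircuit K V m₂) :
    IsEmbedding C (C.append D) (Fin.castAdd D.numGates) := by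
  intro i
  refine ⟨id, fun j => rfl, ?_⟩
  have : ((Fin.castAdd D.numGates i : Fin _) : ℕ) < C.numGates := i.2
  simp only [append]
  rw [dif_pos this]
  cases h : C.gate i <;> simp_all [CircuitGate.map]

theorem isEmbedding_append_right (C : AlgCircuit K V m₁) (D : AlgCircuit K V m₂) :
    IsEmbedding D (C.append D) (Fin.natAdd C.numGates) := by
  intro i
  refine ⟨fun j => ⟨C.numGates + j.val, by simp⟩, fun j => rfl, ?_⟩
  have h0 : ¬ ((Fin.natAdd C.numGates i : Fin _) : ℕ) < C.numGates := by simp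
  simp only [append]
  rw [dif_neg h0]
  obtain ⟨k, hk⟩ := i
  have : C.numGates + k - C.numGates = k := by omega
  have aux : ∀ (l : ℕ) (hl : l < D.numGates) (_ : l = k) (p : ∀ j : Fin l, j.val + C.numGates <
        (Fin.natAdd C.numGates (⟨k, hk⟩ : Fin D.numGates)).val),
      (D.gate ⟨l, hl⟩).map (fun j : Fin l => (⟨j.val + C.numGates, p j⟩ : Fin _)) =
      (D.gate ⟨k, hk⟩).map (fun j : Fin k => (⟨C.numGates + j.val, by simp⟩ : Fin _)) := by
    rintro l hl rfl p
    congr 1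
    funext j
    exact Fin.ext (Nat.add_comm _ _)
  exact aux _ _ this _

theorem size_append (C : AlgCircuit K V m₁) (D : AlgCircuit K V m₂) :
    (C.append D).size = C.size + D.size := by
  have h : ∑ i, ((C.append D).gate i).fanIn =
      ∑ i, (C.gate i).fanIn + ∑ i, (D.gate i).fanIn := by
    refine (Fin.sum_univ_add _).trans ?_
    congr 1
    · refine Finset.sum_congr rfl fun i _ => ?_
      obtain ⟨f, -, hf⟩ := isEmbedding_append_left C D i
      rw [hf, CircuitGate.fanIn_map]
    · refine Finset.sum_congr rfl fun i _ => ?_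
      obtain ⟨f, -, hf⟩ := isEmbedding_append_right C D i
      rw [hf, CircuitGate.fanIn_map]
  rw [size, h, size, size]
  simp only [append]
  omega

theorem depth_append_le {C : AlgCircuit K V m₁} {D : AlgCircuit K V m₂} {Δ : ℕ}
    (hC : C.depth ≤ Δ) (hD : D.depth ≤ Δ) : (C.append D).depth ≤ Δ := by
  refine Finset.sup_le fun i _ => ?_
  have : ∀ i : Fin (C.numGates + D.numGates), (C.append D).gateDepth i ≤ Δ := by
    intro i
    refine Fin.addCases (fun i => ?_) (fun i => ?_) i
    · exact ((isEmbedding_append_left C D).gateDepth_eq i).le.trans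
        ((Finset.le_sup (Finset.mem_univ i)).trans hC)
    · exact ((isEmbedding_append_right C D).gateDepth_eq i).le.trans
        ((Finset.le_sup (Finset.mem_univ i)).trans hD)
  exact this i

theorem eval_append [CommSemiring K] (C : AlgCircuit K V m₁) (D : AlgCircuit K V m₂)
    (x : V → K) : (C.append D).eval x = Fin.append (C.eval x) (D.eval x) := by
  funext i
  refine Fin.addCases (fun i => ?_) (fun i => ?_) i
  · rw [Fin.append_left]
    refine Eq.trans ?_ ((isEmbedding_append_left C D).gateValue_eq x (C.output i))
    simp only [eval, append, Fin.append_left]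
  · rw [Fin.append_right]
    refine Eq.trans ?_ ((isEmbedding_append_right C D).gateValue_eq x (D.output i))
    simp only [eval, append, Fin.append_right]

/-- The circuit `C` with one more gate, which is the only output. -/
def addGate (C : AlgCircuit K V m) (g : CircuitGate K V C.numGates) : AlgCircuit K V 1 where
  numGates := C.numGates + 1
  gate i := if h : i.val < C.numGates then C.gate ⟨i, h⟩ else
    g.map (Fin.castLE (not_lt.1 h))
  output _ := Fin.last _

theorem isEmbedding_addGate (C : AlgCircuit K V m) (g : CircuitGate K V C.numGates) :
    IsEmbedding C (C.addGate g) Fin.castSucc := by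
  intro i
  refine ⟨id, fun j => rfl, ?_⟩
  have : ((Fin.castSucc i : Fin _) : ℕ) < C.numGates := i.2
  simp only [addGate]
  rw [dif_pos this]
  cases h : C.gate i <;> simp_all [CircuitGate.map]

theorem addGate_gate_last (C : AlgCircuit K V m) (g : CircuitGate K V C.numGates) :
    (C.addGate g).gate (Fin.last C.numGates) = g := by
  have : ¬ ((Fin.last C.numGates : Fin _) : ℕ) < C.numGates := by simp
  simp only [addGate]
  rw [dif_neg this]
  cases g <;> simp [CircuitGate.map]

theorem size_addGate (C : AlgCircuit K V m) (g : CircuitGate K V C.numGates) :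
    (C.addGate g).size = C.size + g.fanIn + 1 := by
  have h : ∑ i, ((C.addGate g).gate i).fanIn = ∑ i, (C.gate i).fanIn + g.fanIn := by
    refine (Fin.sum_univ_castSucc (n := C.numGates) _).trans ?_
    rw [addGate_gate_last]
    congr 1
    refine Finset.sum_congr rfl fun i _ => ?_
    obtain ⟨f, -, hf⟩ := isEmbedding_addGate C g i
    rw [hf, CircuitGate.fanIn_map]
  rw [size, h, size]
  simp only [addGate]
  omega

theorem gateDepth_le_of_forall {C : AlgCircuit K V m} {i : Fin C.numGates} {Δ : ℕ}
    (h : ∀ j : Fin i.val, C.gateDepth ⟨j, j.2.trans i.2⟩ ≤ Δ) : C.gateDepth i ≤ Δ + 1 := by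
  have hfold : ∀ l : List ℕ, (∀ a ∈ l, a ≤ Δ) → l.foldr max 0 ≤ Δ := by
    intro l
    induction l with
    | nil => simp
    | cons a l ih =>
      intro h
      simp only [List.mem_cons, forall_eq_or_imp] at h
      exact max_le h.1 (ih h.2)
  rw [gateDepth]
  cases C.gate i with
  | var v => exact Nat.zero_le _
  | const a => exact Nat.zero_le _
  | add l =>
    refine Nat.succ_le_succ (hfold _ fun a ha => ?_)
    obtain ⟨j, -, rfl⟩ := List.mem_map.1 ha
    exact h j
  | mul l =>
    refine Nat.succ_le_succ (hfold _ fun a ha => ?_)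
    obtain ⟨j, -, rfl⟩ := List.mem_map.1 ha
    exact h j

theorem gateValue_of_add [CommSemiring K] {C : AlgCircuit K V m} {i : Fin C.numGates}
    {l : List (Fin i.val)} (h : C.gate i = .add l) (x : V → K) :
    C.gateValue x i = (l.map fun j : Fin i.val => C.gateValue x ⟨j, j.2.trans i.2⟩).sum := by
  rw [gateValue, h]

theorem gateValue_of_mul [CommSemiring K] {C : AlgCircuit K V m} {i : Fin C.numGates}
    {l : List (Fin i.val)} (h : C.gate i = .mul l) (x : V → K) :
    C.gateValue x i = (l.map fun j : Fin i.val => C.gateValue x ⟨j, j.2.trans i.2⟩).prod := by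
  rw [gateValue, h]

theorem depth_addGate_le {C : AlgCircuit K V m} {g : CircuitGate K V C.numGates} {Δ : ℕ}
    (hC : C.depth ≤ Δ) : (C.addGate g).depth ≤ Δ + 1 := by
  have hle : ∀ i : Fin C.numGates, (C.addGate g).gateDepth i.castSucc ≤ Δ := fun i =>
    ((isEmbedding_addGate C g).gateDepth_eq i).le.trans
      ((Finset.le_sup (Finset.mem_univ i)).trans hC)
  have : ∀ i : Fin (C.numGates + 1), (C.addGate g).gateDepth i ≤ Δ + 1 := fun i =>
    Fin.lastCases (gateDepth_le_of_forall fun j => hle j) (fun i => (hle i).trans (Nat.le_succ _)) i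
  exact Finset.sup_le fun i _ => this i

theorem eval_addGate_add [CommSemiring K] (C : AlgCircuit K V m) (l : List (Fin C.numGates))
    (x : V → K) : (C.addGate (.add l)).eval x 0 = (l.map (C.gateValue x)).sum := by
  refine (gateValue_of_add (addGate_gate_last C (.add l)) x).trans ?_
  refine congrArg List.sum (List.map_congr_left fun j _ => ?_)
  exact (isEmbedding_addGate C (.add l)).gateValue_eq x j

theorem eval_addGate_mul [CommSemiring K] (C : AlgCircuit K V m) (l : List (Fin C.numGates))
    (x : V → K) : (C.addGate (.mul l)).eval x 0 = (l.map (C.gateValue x)).prod := by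
  refine (gateValue_of_mul (addGate_gate_last C (.mul l)) x).trans ?_
  refine congrArg List.prod (List.map_congr_left fun j _ => ?_)
  exact (isEmbedding_addGate C (.mul l)).gateValue_eq x j

/-- The circuit with a single leaf. -/
def leaf (g : CircuitGate K V 0) : AlgCircuit K V 1 where
  numGates := 1
  gate _ := g.map (Fin.castLE (Nat.zero_le _))
  output _ := 0

end AlgCircuit

/-! ### Calculus of functions with small shallow circuits. -/

/-- The function `F` is computed by a circuit of size at most `b ^ e` and depth at most `Δ`. -/
def Computes {K V : Type*} [CommSemiring K] (b e Δ : ℕ) (F : (V → K) → K) : Prop :=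
  ∃ C : AlgCircuit K V 1, C.size ≤ b ^ e ∧ C.depth ≤ Δ ∧ ∀ x, C.eval x 0 = F x

namespace Computes

variable {K V : Type*} [CommSemiring K] {b e Δ : ℕ}

open AlgCircuit

theorem congr {F G : (V → K) → K} (h : Computes b e Δ F) (hFG : ∀ x, F x = G x) :
    Computes b e Δ G :=
  (funext hFG : F = G) ▸ h

theorem mono {e' Δ' : ℕ} {F : (V → K) → K} (h : Computes b e Δ F) (hb : 0 < b) (he : e ≤ e')
    (hΔ : Δ ≤ Δ') : Computes b e' Δ' F := by
  obtain ⟨C, h1, h2, h3⟩ := h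
  exact ⟨C, h1.trans (Nat.pow_le_pow_right hb he), h2.trans hΔ, h3⟩

theorem var (v : V) : Computes (K := K) b 0 0 fun x => x v := by
  refine ⟨leaf (.var v), ?_, ?_, fun x => ?_⟩
  · simp [size, leaf, CircuitGate.map, CircuitGate.fanIn]
  · refine Finset.sup_le fun i _ => ?_
    rw [gateDepth]
    simp [leaf, CircuitGate.map]
  · rw [AlgCircuit.eval, gateValue]
    simp [leaf, CircuitGate.map]

theorem const (a : K) : Computes (V := V) b 0 0 fun _ => a := by
  refine ⟨leaf (.const a), ?_, ?_, fun x => ?_⟩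
  · simp [size, leaf, CircuitGate.map, CircuitGate.fanIn]
  · refine Finset.sup_le fun i _ => ?_
    rw [gateDepth]
    simp [leaf, CircuitGate.map]
  · rw [AlgCircuit.eval, gateValue]
    simp [leaf, CircuitGate.map]

theorem exists_parallel {n s : ℕ} {F : Fin n → (V → K) → K}
    (h : ∀ i, ∃ C : AlgCircuit K V 1, C.size ≤ s ∧ C.depth ≤ Δ ∧ ∀ x, C.eval x 0 = F i x) :
    ∃ C : AlgCircuit K V n, C.size ≤ n * s ∧ C.depth ≤ Δ ∧ ∀ x i, C.eval x i = F i x := by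
  induction n with
  | zero =>
    refine ⟨⟨0, fun i => i.elim0, Fin.elim0⟩, ?_, ?_, fun x i => i.elim0⟩
    · simp [size]
    · simp [depth]
  | succ n ih =>
    obtain ⟨C, h1, h2, h3⟩ := ih (F := fun i => F i.castSucc) fun i => h i.castSucc
    obtain ⟨D, h1', h2', h3'⟩ := h (Fin.last n)
    refine ⟨C.append D, ?_, depth_append_le h2 h2', fun x i => ?_⟩
    · rw [size_append, Nat.succ_mul]
      omega
    · rw [eval_append]
      refine Fin.lastCases ?_ (fun i => ?_) i
      · rw [← h3' x]
        exact Fin.append_right _ _ (0 : Fin 1)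
      · rw [← h3 x i]
        exact Fin.append_left _ _ i

/-- Size accounting for one new gate over `n` disjoint subcircuits: `n` wires and the gate itself
are absorbed by the factor `b ^ 2 ≥ 4`. -/
theorem add_add_one_le_pow {n a : ℕ} (hb : 2 ≤ b) (hn : n ≤ b ^ a) {s : ℕ}
    (hs : s ≤ n * b ^ e) : s + n + 1 ≤ b ^ (a + e + 2) := by
  have h1 : 1 ≤ b ^ a := Nat.one_le_pow _ _ (by omega)
  have h2 : 1 ≤ b ^ e := Nat.one_le_pow _ _ (by omega)
  have h3 : n * b ^ e ≤ b ^ a * b ^ e := Nat.mul_le_mul_right _ hn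
  have h4 : b ^ a * 1 ≤ b ^ a * b ^ e := Nat.mul_le_mul_left _ h2
  have h5 : 4 ≤ b ^ 2 := by nlinarith
  have h6 : b ^ a * b ^ e * 4 ≤ b ^ a * b ^ e * b ^ 2 := Nat.mul_le_mul_left _ h5
  rw [pow_add, pow_add]
  omega

theorem sum {n a : ℕ} (hb : 2 ≤ b) (hn : n ≤ b ^ a) {F : Fin n → (V → K) → K}
    (h : ∀ i, Computes b e Δ (F i)) : Computes b (a + e + 2) (Δ + 1) fun x => ∑ i, F i x := by
  obtain ⟨C, h1, h2, h3⟩ := exists_parallel h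
  refine ⟨C.addGate (.add (List.ofFn C.output)), ?_, depth_addGate_le h2, fun x => ?_⟩
  · rw [size_addGate]
    simpa [CircuitGate.fanIn] using add_add_one_le_pow hb hn h1
  · rw [eval_addGate_add, List.map_ofFn, List.sum_ofFn]
    exact Finset.sum_congr rfl fun i _ => h3 x i

theorem prod {n a : ℕ} (hb : 2 ≤ b) (hn : n ≤ b ^ a) {F : Fin n → (V → K) → K}
    (h : ∀ i, Computes b e Δ (F i)) : Computes b (a + e + 2) (Δ + 1) fun x => ∏ i, F i x := by
  obtain ⟨C, h1, h2, h3⟩ := exists_parallel h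
  refine ⟨C.addGate (.mul (List.ofFn C.output)), ?_, depth_addGate_le h2, fun x => ?_⟩
  · rw [size_addGate]
    simpa [CircuitGate.fanIn] using add_add_one_le_pow hb hn h1
  · rw [eval_addGate_mul, List.map_ofFn, List.prod_ofFn]
    exact Finset.prod_congr rfl fun i _ => h3 x i

theorem add (hb : 2 ≤ b) {F G : (V → K) → K} (hF : Computes b e Δ F) (hG : Computes b e Δ G) :
    Computes b (e + 3) (Δ + 1) fun x => F x + G x := by
  have := sum (n := 2) (a := 1) hb (by simpa using hb) (F := ![F, G]) (e := e) (Δ := Δ)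
    (by intro i; fin_cases i <;> assumption)
  refine (this.congr fun x => by simp).mono (by omega) (by omega) le_rfl

theorem mul (hb : 2 ≤ b) {F G : (V → K) → K} (hF : Computes b e Δ F) (hG : Computes b e Δ G) :
    Computes b (e + 3) (Δ + 1) fun x => F x * G x := by
  have := prod (n := 2) (a := 1) hb (by simpa using hb) (F := ![F, G]) (e := e) (Δ := Δ)
    (by intro i; fin_cases i <;> assumption)
  refine (this.congr fun x => by simp).mono (by omega) (by omega) le_rfl

theorem const_mul (hb : 2 ≤ b) (a : K) {F : (V → K) → K} (hF : Computes b e Δ F) :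
    Computes b (e + 3) (Δ + 1) fun x => a * F x :=
  mul hb ((const a).mono (by omega) (Nat.zero_le _) (Nat.zero_le _)) hF

theorem pow {n a : ℕ} (hb : 2 ≤ b) (hn : n ≤ b ^ a) {F : (V → K) → K}
    (h : Computes b e Δ F) : Computes b (a + e + 2) (Δ + 1) fun x => F x ^ n :=
  (prod hb hn (F := fun _ => F) fun _ => h).congr fun x => by simp

end Computes

/-! ### Interpolation: coefficients as linear combinations of values. -/

/-- The weights are a row of the inverse Vandermonde matrix. They lie in `K` but serve every
`K`-algebra `L`, since the products to be interpolated have coefficients in the algebraic closure or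
in polynomials over it. -/
theorem exists_coeff_functional {K : Type*} [Field K] {M : ℕ} {a : Fin M → K}
    (ha : Function.Injective a) (k : ℕ) :
    ∃ c : Fin M → K, ∀ (L : Type*) [CommRing L] [Algebra K L] (P : L[X]), P.natDegree < M →
      P.coeff k = ∑ j, algebraMap K L (c j) * P.eval (algebraMap K L (a j)) := by
  by_cases hk : k < M
  · have hdet : IsUnit (Matrix.vandermonde a).det :=
      (Matrix.det_vandermonde_ne_zero_iff.2 ha).isUnit
    refine ⟨Matrix.vecMul (Pi.single ⟨k, hk⟩ 1) (Matrix.vandermonde a)⁻¹,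
      fun L _ _ P hP => ?_⟩
    set c := Matrix.vecMul (Pi.single ⟨k, hk⟩ 1) (Matrix.vandermonde a)⁻¹ with hc
    have h1 : Matrix.vecMul c (Matrix.vandermonde a) = Pi.single ⟨k, hk⟩ 1 := by
      rw [hc, Matrix.vecMul_vecMul, Matrix.nonsing_inv_mul _ hdet, Matrix.vecMul_one]
    have h2 : ∀ i : Fin M, ∑ j, c j * a j ^ (i : ℕ) = if i = ⟨k, hk⟩ then 1 else 0 := by
      intro i
      have := congrFun h1 i
      rw [Pi.single_apply] at this
      rw [← this]
      simp [Matrix.vecMul, dotProduct, Matrix.vandermonde_apply]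
    have h3 : ∀ i : Fin M, ∑ j, algebraMap K L (c j) * algebraMap K L (a j) ^ (i : ℕ) =
        if i = ⟨k, hk⟩ then 1 else 0 := by
      intro i
      have := congrArg (algebraMap K L) (h2 i)
      simpa [apply_ite] using this
    have h4 : ∀ z : L, P.eval z = ∑ i : Fin M, P.coeff i * z ^ (i : ℕ) := by
      intro z
      rw [eval_eq_sum_range' hP, Finset.sum_range]
    simp_rw [h4, Finset.mul_sum]
    rw [Finset.sum_comm]
    calc P.coeff k = ∑ i : Fin M, P.coeff i * (if i = ⟨k, hk⟩ then 1 else 0) := by simp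
      _ = _ := by
        refine Finset.sum_congr rfl fun i _ => ?_
        rw [← h3, Finset.mul_sum]
        exact Finset.sum_congr rfl fun j _ => by ring
  -- Beyond the degree bound the coefficient is zero, so zero weights work and `k` needs no bound.
  · refine ⟨0, fun L _ _ P hP => ?_⟩
    rw [coeff_eq_zero_of_natDegree_lt (by omega)]
    simp

/-! ### Lagrange inversion with a nilpotent parameter. -/

section Lagrange

variable {R : Type*} [CommRing R]

/-- The truncated Lagrange series `∑ t ^ m [z ^ m] (G ψ ^ m)`. -/
noncomputable def lagrangeSum (t : R) (N : ℕ) (ψ G : PowerSeries R) : R :=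
  ∑ m ∈ Finset.range N, t ^ m * PowerSeries.coeff m (G * ψ ^ m)

theorem lagrangeSum_sub (t : R) (N : ℕ) (ψ G H : PowerSeries R) :
    lagrangeSum t N ψ (G - H) = lagrangeSum t N ψ G - lagrangeSum t N ψ H := by
  simp [lagrangeSum, sub_mul, mul_sub]

theorem lagrangeSum_C_mul (t : R) (N : ℕ) (ψ G : PowerSeries R) (r : R) :
    lagrangeSum t N ψ (PowerSeries.C r * G) = r * lagrangeSum t N ψ G := by
  simp only [lagrangeSum, mul_assoc, PowerSeries.coeff_C_mul, Finset.mul_sum]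
  exact Finset.sum_congr rfl fun m _ => by ring

/-- Multiplication by X shifts the index by one: the term m = 0 disappears on the left, and the top
term on the right carries `t ^ N = 0`. -/
theorem lagrangeSum_X_mul {t : R} {N : ℕ} (ht : t ^ N = 0) (ψ G : PowerSeries R) :
    lagrangeSum t N ψ (PowerSeries.X * G) = t * lagrangeSum t N ψ (ψ * G) := by
  cases N with
  | zero => simp [lagrangeSum]
  | succ n =>
    rw [lagrangeSum, lagrangeSum, Finset.sum_range_succ', Finset.sum_range_succ, mul_add,
      ← mul_assoc t, ← pow_succ', ht, zero_mul, Finset.mul_sum]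
    congr 1
    · refine Finset.sum_congr rfl fun m _ => ?_
      rw [mul_assoc PowerSeries.X, PowerSeries.coeff_succ_X_mul, ← mul_assoc, ← pow_succ',
        pow_succ ψ]
      congr 2
      ring
    · simp

/-- The functional kills multiples of X - tψ by the shift rule. These are the multiples of X - δ, as
`U` is a unit, and G - G(δ) is one of them. -/
theorem lagrangeSum_coe {t δ : R} {N : ℕ} (ht : t ^ N = 0) {ψ U : PowerSeries R} (hU : IsUnit U)
    (h : (PowerSeries.X - PowerSeries.C δ) * U = PowerSeries.X - PowerSeries.C t * ψ)
    (G : R[X]) :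
    lagrangeSum t N ψ G = G.eval δ * lagrangeSum t N ψ 1 := by
  have hker : ∀ Q : PowerSeries R,
      lagrangeSum t N ψ ((PowerSeries.X - PowerSeries.C δ) * Q) = 0 := by
    intro Q
    obtain ⟨V, hV⟩ := hU.exists_right_inv
    have : (PowerSeries.X - PowerSeries.C δ) * Q =
        PowerSeries.X * (V * Q) - PowerSeries.C t * (ψ * (V * Q)) := by
      calc _ = ((PowerSeries.X - PowerSeries.C δ) * (U * V)) * Q := by rw [hV, mul_one]
        _ = ((PowerSeries.X - PowerSeries.C δ) * U) * (V * Q) := by ring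
        _ = _ := by rw [h]; ring
    rw [this, lagrangeSum_sub, lagrangeSum_C_mul, lagrangeSum_X_mul ht, sub_self]
  obtain ⟨Q, hQ⟩ := X_sub_C_dvd_sub_C_eval (a := δ) (p := G)
  have h2 := hker (Q : PowerSeries R)
  have h3 : (PowerSeries.X - PowerSeries.C δ) * (Q : PowerSeries R) =
      (G : PowerSeries R) - PowerSeries.C (G.eval δ) * 1 := by
    have := congrArg (fun p : R[X] => (p : PowerSeries R)) hQ
    simpa using this.symm
  rw [h3, lagrangeSum_sub, lagrangeSum_C_mul, sub_eq_zero] at h2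
  exact h2

theorem exists_lagrangeSum_one (t : R) (N : ℕ) (ψ : PowerSeries R) (ht : t ^ N = 0) :
    ∃ r, lagrangeSum t N ψ 1 = 1 + t * r := by
  cases N with
  | zero =>
    -- For `N = 0` the hypothesis reads 1 = 0.
    have : Subsingleton R := subsingleton_of_zero_eq_one (by simpa using ht.symm)
    exact ⟨0, Subsingleton.elim _ _⟩
  | succ n =>
    refine ⟨∑ m ∈ Finset.range n, t ^ m * PowerSeries.coeff (m + 1) (1 * ψ ^ (m + 1)), ?_⟩
    rw [lagrangeSum, Finset.sum_range_succ', Finset.mul_sum, add_comm]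
    congr 1
    · simp
    · exact Finset.sum_congr rfl fun m _ => by ring

theorem eval_eq_lagrangeSum {t δ : R} {N : ℕ} (ht : t ^ N = 0) {ψ U : PowerSeries R}
    (hU : IsUnit U)
    (h : (PowerSeries.X - PowerSeries.C δ) * U = PowerSeries.X - PowerSeries.C t * ψ)
    (G : R[X]) :
    G.eval δ = lagrangeSum t N ψ G *
      ∑ j ∈ Finset.range N, (1 - lagrangeSum t N ψ 1) ^ j := by
  obtain ⟨r, hr⟩ := exists_lagrangeSum_one t N ψ ht
  have hg := mul_neg_geom_sum (1 - lagrangeSum t N ψ 1) N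
  have h0 : (1 - lagrangeSum t N ψ 1) ^ N = 0 := by
    rw [hr, sub_add_cancel_left, neg_pow, mul_pow, ht]
    simp
  rw [h0, sub_sub_cancel, sub_zero] at hg
  rw [lagrangeSum_coe ht hU h, mul_assoc, hg, mul_one]

/-- A monic polynomial whose values at approximate roots, pairwise distinct modulo every maximal
ideal, are nilpotent, splits with roots close to the given ones. -/
theorem exists_roots_of_isNilpotent [Nontrivial R] {n : ℕ} {α : Fin n → R}
    (hα : ∀ i j, i ≠ j → IsUnit (α i - α j)) {F : R[X]} (hF : F.Monic) (hn : F.natDegree = n)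
    (h0 : ∀ i, IsNilpotent (F.eval (α i))) (h1 : ∀ i, IsUnit (F.derivative.eval (α i))) :
    ∃ φ : Fin n → R, (∀ i, IsNilpotent (α i - φ i)) ∧ F = ∏ i, (X - C (φ i)) := by
  have hex : ∀ i, ∃ r, IsNilpotent (α i - r) ∧ aeval r F = 0 := fun i =>
    (existsUnique_nilpotent_sub_and_aeval_eq_zero (P := F) (x := α i)
      (by simpa [coe_aeval_eq_eval] using h0 i) (by simpa [coe_aeval_eq_eval] using h1 i)).exists
  choose φ hφ hφ' using hex
  refine ⟨φ, hφ, ?_⟩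
  have hm : (∏ i, (X - C (φ i))).Monic := monic_prod_of_monic _ _ fun i _ => monic_X_sub_C _
  -- `R` may have zero divisors, so distinct roots are not enough: the differences of the lifted
  -- roots are units up to nilpotents, hence units, which makes the linear factors coprime.
  refine (eq_of_monic_of_dvd_of_natDegree_le hm hF ?_ ?_)
  · refine Finset.prod_dvd_of_coprime ?_ ?_
    · intro i _ j _ hij
      refine isCoprime_X_sub_C_of_isUnit_sub ?_
      have hnil : IsNilpotent ((α j - φ j) - (α i - φ i)) :=
        (Commute.all _ _).isNilpotent_sub (hφ j) (hφ i)
      have := hnil.isUnit_add_left_of_commute (hα i j hij) (Commute.all _ _)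
      convert this using 1
      ring
    · intro i _
      exact dvd_iff_isRoot.2 (by simpa [coe_aeval_eq_eval] using hφ' i)
  · rw [hn, natDegree_prod_of_monic _ _ fun i _ => monic_X_sub_C _]
    simp

end Lagrange

/-! ### Degrees in the deformation parameter, and the value at a perturbed root. -/

theorem natDegree_resultant_le {R : Type*} [CommRing R] {f g : R[X][X]} (m n : ℕ)
    (hf : ∀ i, (f.coeff i).natDegree ≤ 1) (hg : ∀ i, (g.coeff i).natDegree ≤ 1) :
    (resultant f g m n).natDegree ≤ m + n := by
  have hent : ∀ i j, (sylvester f g m n i j).natDegree ≤ 1 := by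
    intro i j
    rw [sylvester, Matrix.of_apply]
    refine Fin.addCases (fun j => ?_) (fun j => ?_) j
    · simp only [Fin.addCases_left]
      split_ifs
      exacts [hg _, by simp]
    · simp only [Fin.addCases_right]
      split_ifs
      exacts [hf _, by simp]
  rw [resultant, Matrix.det_apply]
  refine natDegree_sum_le_of_forall_le _ _ fun σ _ => ?_
  have hz : ((Equiv.Perm.sign σ) • ∏ i, sylvester f g m n (σ i) i).natDegree ≤
      (∏ i, sylvester f g m n (σ i) i).natDegree := by
    rcases Int.units_eq_one_or (Equiv.Perm.sign σ) with h | h <;> simp [h]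
  refine hz.trans ((natDegree_prod_le _ _).trans ?_)
  refine (Finset.sum_le_sum fun i _ => hent (σ i) i).trans ?_
  simp

section Lagrange

variable {R S : Type*} [CommRing R] [CommRing S]

theorem map_lagrangeSum (θ : R →+* S) (t : R) (N : ℕ) (ψ G : PowerSeries R) :
    θ (lagrangeSum t N ψ G) =
      lagrangeSum (θ t) N (PowerSeries.map θ ψ) (PowerSeries.map θ G) := by
  simp only [lagrangeSum, map_sum, map_mul, map_pow, ← PowerSeries.coeff_map]

/-- `lagrangeSum` divided by its value at `1`. -/
noncomputable def lagrangeValue (t : R) (N : ℕ) (ψ G : PowerSeries R) : R :=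
  lagrangeSum t N ψ G * ∑ j ∈ Finset.range N, (1 - lagrangeSum t N ψ 1) ^ j

theorem map_lagrangeValue (θ : R →+* S) (t : R) (N : ℕ) (ψ G : PowerSeries R) :
    θ (lagrangeValue t N ψ G) =
      lagrangeValue (θ t) N (PowerSeries.map θ ψ) (PowerSeries.map θ G) := by
  simp only [lagrangeValue, map_mul, map_sum, map_pow, map_sub, map_one, map_lagrangeSum]

theorem natDegree_lagrangeSum_le (N : ℕ) (ψ G : PowerSeries R) :
    (lagrangeSum (X : R[X]) N (PowerSeries.map C ψ) (PowerSeries.map C G)).natDegree ≤ N := by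
  refine natDegree_sum_le_of_forall_le _ _ fun m hm => ?_
  rw [← map_pow, ← map_mul, PowerSeries.coeff_map, mul_comm]
  exact (natDegree_C_mul_X_pow_le _ _).trans (Finset.mem_range.1 hm).le

theorem natDegree_lagrangeValue_le (N : ℕ) (ψ G : PowerSeries R) :
    (lagrangeValue (X : R[X]) N (PowerSeries.map C ψ) (PowerSeries.map C G)).natDegree ≤
      N + N * N := by
  refine natDegree_mul_le.trans (add_le_add (natDegree_lagrangeSum_le N ψ G) ?_)
  refine natDegree_sum_le_of_forall_le _ _ fun j hj => natDegree_pow_le.trans ?_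
  refine Nat.mul_le_mul (Finset.mem_range.1 hj).le ?_
  refine (natDegree_sub_le _ _).trans ?_
  have := natDegree_lagrangeSum_le N ψ 1
  rw [map_one] at this
  simpa using this

/-- Recentring `hF` at β and multiplying by the inverse `w` of `h` gives (X - δ) · (H w) = X - tψ
with δ = φ - β and ψ = -u w; the factor H w is a unit because its constant coefficient is. -/
theorem eval_eq_lagrangeValue {t β φ : R} {N : ℕ} (ht : t ^ N = 0) {h u H : R[X]}
    (hF : (X - C φ) * H = (X - C β) * h + C t * u) (hH : IsUnit (H.eval β))
    {w : PowerSeries R} (hw : (taylor β h : PowerSeries R) * w = 1) (G : R[X]) :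
    G.eval φ = lagrangeValue t N (-((taylor β u : PowerSeries R) * w)) (taylor β G) := by
  have hunit : IsUnit ((taylor β H : PowerSeries R) * w) := by
    refine IsUnit.mul ?_ (IsUnit.of_mul_eq_one _ (by rw [mul_comm]; exact hw))
    rw [PowerSeries.isUnit_iff_constantCoeff]
    simpa using hH
  have hX : taylor β (X - C φ) = X - C (φ - β) := by
    simp [taylor_X]
    ring
  have hX' : taylor β (X - C β) = X := by
    simp [taylor_X]
  have hT := congrArg (fun p : R[X] => (taylor β p : PowerSeries R)) hF
  simp only [map_add, taylor_mul, taylor_C, hX, hX', Polynomial.coe_mul, Polynomial.coe_add,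
    Polynomial.coe_sub, Polynomial.coe_X, Polynomial.coe_C] at hT
  rw [lagrangeValue, ← eval_eq_lagrangeSum ht hunit (δ := φ - β), taylor_eval, sub_add_cancel]
  rw [← mul_assoc, hT]
  linear_combination PowerSeries.X * hw

end Lagrange

/-! ### The resultant along a deformation from a split polynomial. -/

theorem resultant_prod_X_sub_C {R : Type*} [CommRing R] [Nontrivial R] {n d : ℕ} (φ : Fin n → R)
    {G : R[X]} (hG : G.natDegree ≤ d) :
    (∏ i, (X - C (φ i))).resultant G n d = ∏ i, G.eval (φ i) := by
  have hdeg : (∏ i, (X - C (φ i))).natDegree = n := by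
    rw [natDegree_prod_of_monic _ _ fun i _ => monic_X_sub_C _]
    simp
  have := resultant_prod_left (Finset.univ : Finset (Fin n)) (fun i => X - C (φ i)) G d
    (by simp [(monic_X_sub_C _).leadingCoeff]) hG
  rw [hdeg] at this
  rw [this]
  refine Finset.prod_congr rfl fun i _ => ?_
  rw [natDegree_X_sub_C, resultant_X_sub_C_left _ _ _ hG]

section Resultant

variable {K : Type*} [Field K] {n : ℕ}

/-- The inverse of `∏ j ≠ i, (X - α j)` as a power series at `α i`. -/
noncomputable def cofactorInv (α : Fin n → K) (i : Fin n) : PowerSeries K :=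
  ((taylor (α i) (∏ j ∈ Finset.univ.erase i, (X - C (α j))) : K[X]) : PowerSeries K)⁻¹

/-- The power series `- u / ∏ j ≠ i, (X - α j)` at `α i`. -/
noncomputable def lagrangeKernel (α : Fin n → K) (u : K[X]) (i : Fin n) : PowerSeries K :=
  -((taylor (α i) u : PowerSeries K) * cofactorInv α i)

theorem taylor_mul_cofactorInv {α : Fin n → K} (hα : Function.Injective α) (i : Fin n) :
    ((taylor (α i) (∏ j ∈ Finset.univ.erase i, (X - C (α j))) : K[X]) : PowerSeries K) *
      cofactorInv α i = 1 := by
  refine PowerSeries.mul_inv_cancel _ ?_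
  have : ∏ j ∈ Finset.univ.erase i, (α i - α j) ≠ 0 := by
    refine Finset.prod_ne_zero_iff.2 fun j hj => sub_ne_zero.2 fun h => ?_
    exact (Finset.mem_erase.1 hj).1 (hα h).symm
  simpa [eval_prod] using this

/-- The product of the truncated Lagrange series of `G` at the roots of `h + t u`,
`h = ∏ i, (X - α i)`. -/
noncomputable def lagrangeNorm {R : Type*} [CommRing R] (θ : K →+* R) (t : R) (N : ℕ)
    (α : Fin n → K) (u G : K[X]) : R :=
  ∏ i, lagrangeValue t N (PowerSeries.map θ (lagrangeKernel α u i))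
    (PowerSeries.map θ (taylor (α i) G))

/-- Naturality lets one expression be read in K[t], in K[t]/(t^N), where it is a resultant, and in
K, where a circuit evaluates it. -/
theorem map_lagrangeNorm {R S : Type*} [CommRing R] [CommRing S] (χ : R →+* S) (θ : K →+* R)
    (t : R) (N : ℕ) (α : Fin n → K) (u G : K[X]) :
    χ (lagrangeNorm θ t N α u G) = lagrangeNorm (χ.comp θ) (χ t) N α u G := by
  simp only [lagrangeNorm, map_prod, map_lagrangeValue, PowerSeries.map_comp,
    RingHom.comp_apply]

/-- At `α i` the deformed polynomial has nilpotent value and unit derivative, so it splits with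
roots near the `α i`; the resultant is the product of the values of `G` there, each given by
Lagrange inversion. -/
theorem resultant_deformation_eq {R : Type*} [CommRing R] [Nontrivial R] (θ : K →+* R) {t : R}
    {N : ℕ} (ht : t ^ N = 0) {α : Fin n → K} (hα : Function.Injective α) {u : K[X]}
    (hu : u.degree < n) {G : K[X]} {d : ℕ} (hG : G.natDegree ≤ d) :
    ((∏ i, (X - C (α i))).map θ + C t * u.map θ).resultant (G.map θ) n d =
      lagrangeNorm θ t N α u G := by
  classical
  set h : K[X] := ∏ i, (X - C (α i)) with hh
  have hhm : h.Monic := monic_prod_of_monic _ _ fun i _ => monic_X_sub_C _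
  have hhd : h.natDegree = n := by
    rw [hh, natDegree_prod_of_monic _ _ fun i _ => monic_X_sub_C _]
    simp
  have hnil : IsNilpotent t := ⟨N, ht⟩
  have hlt : (C t * u.map θ).degree < (h.map θ).degree := by
    rw [degree_eq_natDegree (hhm.map θ).ne_zero, hhm.natDegree_map, hhd]
    refine lt_of_le_of_lt ?_ hu
    rw [C_mul']
    exact (degree_smul_le _ _).trans degree_map_le
  have hFm : (h.map θ + C t * u.map θ).Monic := (hhm.map θ).add_of_left hlt
  have hFd : (h.map θ + C t * u.map θ).natDegree = n := by
    rw [natDegree_add_eq_left_of_degree_lt hlt, hhm.natDegree_map, hhd]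
  have hroot : ∀ i, h.eval (α i) = 0 := fun i => by
    rw [hh, eval_prod]
    exact Finset.prod_eq_zero (Finset.mem_univ i) (by simp)
  have hsep : h.Separable := separable_prod_X_sub_C_iff.2 hα
  obtain ⟨φ, hφ, hF⟩ := exists_roots_of_isNilpotent (α := fun i => θ (α i))
    (fun i j hij => by
      rw [← map_sub]
      exact (sub_ne_zero.2 (hα.ne hij)).isUnit.map θ) hFm hFd
    (fun i => by
      simp only [eval_add, eval_mul, eval_C, eval_map_apply, hroot, map_zero, zero_add]
      exact (Commute.all _ _).isNilpotent_mul_right hnil)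
    (fun i => by
      simp only [derivative_add, derivative_map, derivative_C_mul, eval_add, eval_mul, eval_C,
        eval_map_apply]
      refine ((Commute.all _ _).isNilpotent_mul_right hnil).isUnit_add_left_of_commute ?_
        (Commute.all _ _)
      have := hsep.aeval_derivative_ne_zero (x := α i) (by simpa [coe_aeval_eq_eval] using hroot i)
      exact (IsUnit.mk0 _ (by simpa [coe_aeval_eq_eval] using this)).map θ)
  rw [hF, resultant_prod_X_sub_C _ (natDegree_map_le.trans hG), lagrangeNorm]
  refine Finset.prod_congr rfl fun i _ => ?_
  have hw := congrArg (PowerSeries.map θ) (taylor_mul_cofactorInv hα i)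
  rw [map_mul, map_one, ← polynomial_map_coe, map_taylor] at hw
  rw [eval_eq_lagrangeValue ht (β := θ (α i)) (φ := φ i)
    (H := ∏ j ∈ Finset.univ.erase i, (X - C (φ j))) (u := u.map θ) ?_ ?_ hw]
  · rw [lagrangeKernel, map_neg, map_mul, ← polynomial_map_coe, ← polynomial_map_coe,
      map_taylor, map_taylor]
  · rw [Finset.mul_prod_erase _ (fun j => X - C (φ j)) (Finset.mem_univ i), ← hF, hh,
      ← Finset.mul_prod_erase _ (fun j => X - C (α j)) (Finset.mem_univ i)]
    simp
  · rw [eval_prod, IsUnit.prod_iff]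
    intro j hj
    have hij : i ≠ j := (Finset.mem_erase.1 hj).1.symm
    have h1 : IsUnit (θ (α i) - θ (α j)) := by
      rw [← map_sub]
      exact (sub_ne_zero.2 (hα.ne hij)).isUnit.map θ
    have := (hφ j).isUnit_add_left_of_commute h1 (Commute.all _ _)
    simpa using this

theorem natDegree_lagrangeNorm_le (N : ℕ) (α : Fin n → K) (u G : K[X]) :
    (lagrangeNorm (C : K →+* K[X]) X N α u G).natDegree ≤ n * (N + N * N) := by
  refine (natDegree_prod_le _ _).trans
    ((Finset.sum_le_sum fun i _ => natDegree_lagrangeValue_le N _ _).trans ?_)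
  simp

/-- The resultant of h + t u and G is a polynomial in t of degree at most n + d < N, so its class
mod t^N determines it, and its value at t = 1 is the sum of its coefficients. The coefficients of
`lagrangeNorm` from index `N` on carry no meaning and are discarded. -/
theorem resultant_eq_sum_coeff_lagrangeNorm {α : Fin n → K} (hα : Function.Injective α)
    {f G : K[X]} (hf : f.Monic) (hn : f.natDegree = n) {d N : ℕ} (hG : G.natDegree ≤ d)
    (hN : n + d < N) :
    f.resultant G n d = ∑ j ∈ Finset.range N,
      (lagrangeNorm C X N α (f - ∏ i, (X - C (α i))) G).coeff j := by
  set h : K[X] := ∏ i, (X - C (α i)) with hh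
  set u := f - h with hu
  have hhm : h.Monic := monic_prod_of_monic _ _ fun i _ => monic_X_sub_C _
  have hhd : h.natDegree = n := by
    rw [hh, natDegree_prod_of_monic _ _ fun i _ => monic_X_sub_C _]
    simp
  have hud : u.degree < n := by
    have := degree_sub_lt_left (p := f) (q := h)
      (by rw [degree_eq_natDegree hf.ne_zero, degree_eq_natDegree hhm.ne_zero, hn, hhd]) hf.ne_zero
      (by rw [hf.leadingCoeff, hhm.leadingCoeff])
    rwa [degree_eq_natDegree hf.ne_zero, hn] at this
  set Q : K[X] := (h.map C + C X * u.map C).resultant (G.map C) n d with hQ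
  have hQdeg : Q.natDegree ≤ n + d := by
    refine natDegree_resultant_le _ _ (fun i => ?_) (fun i => by simp)
    rw [coeff_add, coeff_C_mul, coeff_map, coeff_map]
    refine (natDegree_add_le _ _).trans (max_le (by simp) ?_)
    rw [mul_comm]
    exact natDegree_C_mul_le _ _ |>.trans natDegree_X_le
  have hQ1 : Q.eval 1 = f.resultant G n d := by
    have hid : (evalRingHom (1 : K)).comp C = RingHom.id K := by ext; simp
    rw [← coe_evalRingHom, hQ, ← resultant_map_map]
    congr 1
    · rw [Polynomial.map_add, Polynomial.map_mul, map_map, map_map, hid, map_C, map_id, map_id]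
      simp [hu]
    · rw [map_map, hid, map_id]
  set I : Ideal K[X] := Ideal.span {X ^ N} with hI
  have hNpos : N ≠ 0 := by omega
  have hInt : I ≠ ⊤ := by
    rw [hI, Ne, Ideal.span_singleton_eq_top, isUnit_pow_iff hNpos]
    exact not_isUnit_X
  have : Nontrivial (K[X] ⧸ I) := Ideal.Quotient.nontrivial_iff.2 hInt
  have hcongr : Ideal.Quotient.mk I Q = Ideal.Quotient.mk I (lagrangeNorm C X N α u G) := by
    rw [map_lagrangeNorm, ← resultant_deformation_eq ((Ideal.Quotient.mk I).comp C) (N := N) ?_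
      hα hud hG, hQ]
    · rw [← resultant_map_map]
      rw [← hh]
      congr 1
      · rw [Polynomial.map_add, Polynomial.map_mul, map_map, map_map, map_C]
      · rw [map_map]
    · rw [← map_pow, Ideal.Quotient.eq_zero_iff_mem]
      exact Ideal.mem_span_singleton_self _
  rw [Ideal.Quotient.eq, hI, Ideal.mem_span_singleton, X_pow_dvd_iff] at hcongr
  rw [← hQ1, eval_eq_sum_range' (lt_of_le_of_lt hQdeg hN)]
  refine Finset.sum_congr rfl fun j hj => ?_
  rw [one_pow, mul_one, ← sub_eq_zero, ← coeff_sub]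
  exact hcongr j (Finset.mem_range.1 hj)

theorem eval_lagrangeNorm (N : ℕ) (α : Fin n → K) (u G : K[X]) (a : K) :
    (lagrangeNorm C X N α u G).eval a =
      ∏ i, lagrangeValue a N (lagrangeKernel α u i) (taylor (α i) G) := by
  have hid : (evalRingHom a).comp C = RingHom.id K := by ext; simp
  rw [← coe_evalRingHom, map_lagrangeNorm, hid, lagrangeNorm]
  simp [PowerSeries.map_id]

end Resultant

/-! ### Constant-depth circuits for the resultant. -/

/-- The coefficient is linear in `P`: Taylor coefficients at β come from interpolation at the
shifted nodes `a b - β`, and `w` only contributes constants. -/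
theorem exists_coeff_taylor_mul {K : Type*} [Field K] {M : ℕ} {a : Fin M → K}
    (ha : Function.Injective a) (β : K) (w : PowerSeries K) (m : ℕ) :
    ∃ c : Fin M → K, ∀ P : K[X], P.natDegree < M →
      PowerSeries.coeff m ((taylor β P : PowerSeries K) * w) = ∑ b, c b * P.eval (a b) := by
  have ha' : Function.Injective fun b => a b - β := fun b b' h => ha (sub_left_injective h)
  choose c hc using fun k => exists_coeff_functional ha' k
  refine ⟨fun b => ∑ p ∈ Finset.HasAntidiagonal.antidiagonal m, c p.1 b * PowerSeries.coeff p.2 w,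
    fun P hP => ?_⟩
  simp_rw [PowerSeries.coeff_mul, Polynomial.coeff_coe, Finset.sum_mul]
  rw [Finset.sum_comm]
  refine Finset.sum_congr rfl fun p _ => ?_
  rw [hc p.1 K (taylor β P) (by rwa [natDegree_taylor]), Finset.sum_mul]
  refine Finset.sum_congr rfl fun b _ => ?_
  simp only [Algebra.algebraMap_self, RingHom.id_apply, taylor_eval, sub_add_cancel]
  ring

theorem exists_sum_coeff_functional {K : Type*} [Field K] {M : ℕ} {a : Fin M → K}
    (ha : Function.Injective a) (N : ℕ) :
    ∃ c : Fin M → K, ∀ P : K[X], P.natDegree < M →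
      ∑ k ∈ Finset.range N, P.coeff k = ∑ j, c j * P.eval (a j) := by
  choose c hc using fun k => exists_coeff_functional ha k
  refine ⟨fun j => ∑ k ∈ Finset.range N, c k j, fun P hP => ?_⟩
  simp_rw [Finset.sum_mul]
  rw [Finset.sum_comm]
  refine Finset.sum_congr rfl fun k _ => ?_
  simpa using hc k K P hP

namespace Computes

variable {K V : Type*} [Field K] {b e Δ r n d M N : ℕ} {a : Fin M → K}

theorem lagrangeSum (hb : 2 ≤ b) (ha : Function.Injective a) (hM : M ≤ b ^ r) (hN : N ≤ b ^ r)
    (hMd : d + N * n < M) {u G : (V → K) → K[X]} (hu : ∀ x, (u x).natDegree ≤ n)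
    (hG : ∀ x, (G x).natDegree ≤ d) (cu : ∀ p, Computes b e Δ fun x => (u x).eval p)
    (cG : ∀ p, Computes b e Δ fun x => (G x).eval p) (t : K) (α : Fin n → K) (i : Fin n) :
    Computes b (3 * r + e + 15) (Δ + 6) fun x =>
      _root_.lagrangeSum t N (lagrangeKernel α (u x) i) (taylor (α i) (G x)) := by
  -- The kernel is u times a series independent of the input, so its m-th power is u^m times a fixed
  -- series and the weights are constants of the circuit.
  choose c hc using fun m => exists_coeff_taylor_mul ha (α i) ((-cofactorInv α i) ^ m) m
  have hterm : ∀ m : Fin N, Computes b (2 * r + e + 13) (Δ + 5) fun x =>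
      t ^ (m : ℕ) * ∑ l, c m l * ((G x).eval (a l) * (u x).eval (a l) ^ (m : ℕ)) := by
    intro m
    refine (const_mul hb _ (sum hb hM fun l => const_mul hb (c m l) (mul hb
      ((cG (a l)).mono (by omega) (by omega) (Nat.le_succ Δ))
      (pow hb (m.2.le.trans hN) (cu (a l)))))).mono (by omega) (by omega) le_rfl
  refine ((sum hb hN hterm).mono (by omega) (by omega) le_rfl).congr fun x => ?_
  rw [_root_.lagrangeSum, Finset.sum_range]
  refine Finset.sum_congr rfl fun m _ => ?_
  have hdeg : (G x * u x ^ (m : ℕ)).natDegree < M := by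
    refine lt_of_le_of_lt (natDegree_mul_le.trans (add_le_add (hG x) ?_)) hMd
    exact natDegree_pow_le.trans (Nat.mul_le_mul m.2.le (hu x))
  have := hc m _ hdeg
  simp only [eval_mul, eval_pow] at this
  rw [← this]
  congr 2
  rw [taylor_mul, taylor_pow, lagrangeKernel, Polynomial.coe_mul, Polynomial.coe_pow, mul_assoc,
    ← mul_pow, mul_neg]

theorem lagrangeValue (hb : 2 ≤ b) (ha : Function.Injective a) (hM : M ≤ b ^ r)
    (hN : N ≤ b ^ r) (hMd : d + N * n < M) {u G : (V → K) → K[X]}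
    (hu : ∀ x, (u x).natDegree ≤ n) (hG : ∀ x, (G x).natDegree ≤ d)
    (cu : ∀ p, Computes b e Δ fun x => (u x).eval p)
    (cG : ∀ p, Computes b e Δ fun x => (G x).eval p) (t : K) (α : Fin n → K) (i : Fin n) :
    Computes b (5 * r + e + 28) (Δ + 11) fun x =>
      _root_.lagrangeValue t N (lagrangeKernel α (u x) i) (taylor (α i) (G x)) := by
  have h1 := lagrangeSum (G := fun _ => 1) hb ha hM hN hMd hu (fun x => by simp) cu
    (fun p => (((const 1).mono (by omega) (Nat.zero_le _) (Nat.zero_le _)).congr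
      fun x => (eval_one).symm)) t α i
  have h2 := lagrangeSum hb ha hM hN hMd hu hG cu cG t α i
  have h3 := add hb ((const 1).mono (by omega) (Nat.zero_le _) (Nat.zero_le _))
    (const_mul hb (-1) h1)
  have h4 := sum hb hN fun j : Fin N => pow hb (j.2.le.trans hN) h3
  refine ((mul hb (h2.mono (by omega) ?_ ?_) h4).mono (by omega) ?_ ?_).congr fun x => ?_
  · omega
  · omega
  · omega
  · omega
  · rw [_root_.lagrangeValue, Finset.sum_range]
    simp [sub_eq_add_neg]

/-- The resultant of `f` and `G`, for monic `f`, is computed by circuits of constant depth. -/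
theorem resultant (hb : 2 ≤ b) (ha : Function.Injective a) (hM : M ≤ b ^ r) (hN : N ≤ b ^ r)
    (hMd : d + N * n < M) (hMn : n * (N + N * N) < M) (hnd : n + d < N)
    {f G : (V → K) → K[X]} (hf : ∀ x, (f x).Monic) (hfn : ∀ x, (f x).natDegree = n)
    (hG : ∀ x, (G x).natDegree ≤ d) (cf : ∀ p, Computes b e Δ fun x => (f x).eval p)
    (cG : ∀ p, Computes b e Δ fun x => (G x).eval p) :
    Computes b (7 * r + e + 38) (Δ + 15) fun x => (f x).resultant (G x) n d := by
  have hnM : n ≤ M := by nlinarith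
  -- The roots of the starting polynomial are taken among the interpolation nodes.
  set α : Fin n → K := fun i => a (Fin.castLE hnM i) with hα
  have hαi : Function.Injective α := ha.comp (Fin.castLE_injective hnM)
  set h : K[X] := ∏ i, (X - C (α i)) with hh
  have hhd : h.natDegree = n := by
    rw [hh, natDegree_prod_of_monic _ _ fun i _ => monic_X_sub_C _]
    simp
  obtain ⟨c, hc⟩ := exists_sum_coeff_functional ha N
  have cu : ∀ p, Computes b (e + 3) (Δ + 1) fun x => (f x - h).eval p := fun p =>
    (add hb (cf p) ((const (-h.eval p)).mono (by omega) (Nat.zero_le _) (Nat.zero_le _))).congr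
      fun x => by rw [eval_sub, sub_eq_add_neg]
  have cval : ∀ (t : K) (i : Fin n), _ := fun t i => lagrangeValue hb ha hM hN hMd
    (u := fun x => f x - h) (fun x => (natDegree_sub_le _ _).trans (by rw [hfn, hhd, max_self]))
    hG cu (fun p => (cG p).mono (by omega) (by omega) (by omega)) t α i
  -- Here t is a field element and the values are no longer values of `G` at roots; they are just
  -- values of a polynomial in t to be interpolated.
  have cnorm := fun t : K => prod hb (hnM.trans hM) (cval t)
  refine ((sum hb hM fun l : Fin M => const_mul hb (c l) (cnorm (a l))).mono
    (by omega) (by omega) le_rfl).congr fun x => ?_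
  rw [resultant_eq_sum_coeff_lagrangeNorm hαi (hf x) (hfn x) (hG x) hnd,
    hc _ (lt_of_le_of_lt (natDegree_lagrangeNorm_le _ _ _ _) hMn)]
  exact Finset.sum_congr rfl fun l _ => by rw [eval_lagrangeNorm]

end Computes

/-! ### Elementary symmetric functions and the filter. -/

namespace Multiset

variable {R : Type*} [CommRing R]

theorem esymm_cons_succ (a : R) (s : Multiset R) (k : ℕ) :
    (a ::ₘ s).esymm (k + 1) = s.esymm (k + 1) + a * s.esymm k := by
  simp [esymm, powersetCard_cons, Multiset.map_map, Multiset.sum_map_mul_left]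

theorem esymm_zero_right (s : Multiset R) : s.esymm 0 = 1 := by
  simp [esymm]

theorem coeff_prod_one_add_C_mul_X (s : Multiset R) (k : ℕ) :
    (s.map fun x => 1 + C x * X).prod.coeff k = s.esymm k := by
  induction s using Multiset.induction generalizing k with
  | empty =>
    cases k with
    | zero => simp [esymm]
    | succ k => simp [esymm, coeff_one, powersetCard_zero_right]
  | cons a s ih =>
    rw [map_cons, prod_cons, add_mul, one_mul, coeff_add, ih]
    cases k with
    | zero => simp [esymm_zero_right, mul_assoc]
    | succ k => rw [mul_assoc, coeff_C_mul, coeff_X_mul, ih, esymm_cons_succ]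

theorem natDegree_prod_map_le {ι : Type*} (s : Multiset ι) (F : ι → R[X])
    (hF : ∀ i, (F i).natDegree ≤ 1) : (s.map F).prod.natDegree ≤ card s := by
  induction s using Multiset.induction with
  | empty => simp
  | cons a s ih =>
    rw [map_cons, prod_cons, card_cons, add_comm]
    exact natDegree_mul_le.trans (add_le_add (hF a) ih)

theorem natDegree_esymm_le {s : Multiset R[X]} (hs : ∀ p ∈ s, p.natDegree ≤ 1) (k : ℕ) :
    (s.esymm k).natDegree ≤ k := by
  induction s using Multiset.induction generalizing k with
  | empty => cases k <;> simp [esymm, powersetCard_zero_right]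
  | cons a s ih =>
    cases k with
    | zero => simp [esymm_zero_right]
    | succ k =>
      rw [esymm_cons_succ]
      refine (natDegree_add_le _ _).trans
        (max_le (ih (fun p hp => hs p (mem_cons_of_mem hp)) _) ?_)
      rw [add_comm k]
      exact natDegree_mul_le.trans (add_le_add (hs a (mem_cons_self a s))
        (ih (fun p hp => hs p (mem_cons_of_mem hp)) _))

theorem esymm_map_filter {ι : Type*} (s : Multiset ι) (p : ι → Prop) [DecidablePred p]
    (w : ι → R) (h : ∀ i, ¬ p i → w i = 0) (k : ℕ) :
    (s.map w).esymm k = ((s.filter p).map w).esymm k := by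
  induction s using Multiset.induction generalizing k with
  | empty => simp
  | cons a s ih =>
    cases k with
    | zero => simp [esymm_zero_right]
    | succ k =>
      by_cases ha : p a
      · rw [filter_cons_of_pos _ ha, map_cons, map_cons, esymm_cons_succ, esymm_cons_succ, ih, ih]
      · rw [filter_cons_of_neg _ ha, map_cons, esymm_cons_succ, h a ha, zero_mul, add_zero, ih]

theorem esymm_eq_zero_of_card_lt {s : Multiset R} {k : ℕ} (h : card s < k) : s.esymm k = 0 := by
  simp [esymm, powersetCard_eq_empty _ h]

theorem esymm_card (s : Multiset R) : s.esymm (card s) = s.prod := by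
  simp [esymm, powersetCard_self]

end Multiset

open Classical in
theorem filterNe_eq_prod {K : Type*} [Field K] (f g : K[X]) :
    filterNe f g = (((f.aroots (AlgebraicClosure K)).filter fun σ => aeval σ g ≠ 0).map
      fun σ => X - C σ).prod := by
  rw [filterNe, Finset.prod_multiset_map_count, Multiset.toFinset_filter]
  refine Finset.prod_congr (by ext; simp) fun σ hσ => ?_
  rw [Multiset.count_filter_of_pos (p := fun σ => aeval σ g ≠ 0) (Finset.mem_filter.1 hσ).2]

/-- If `T` is the sequence of elementary symmetric functions of the `g(σ)` and `A` that of
the `(y - σ) g(σ)`, then the last nonzero `T r` selects the filter. -/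
theorem exists_isGreatest_filterNe {K : Type*} [Field K] {f g : K[X]} {d : ℕ}
    (hd : Multiset.card (f.aroots (AlgebraicClosure K)) = d) {T : ℕ → K} {A : ℕ → K[X]}
    (hT : ∀ k ≤ d, algebraMap K (AlgebraicClosure K) (T k) =
      ((f.aroots (AlgebraicClosure K)).map fun σ => aeval σ g).esymm k)
    (hA : ∀ k ≤ d, (A k).map (algebraMap K (AlgebraicClosure K)) =
      ((f.aroots (AlgebraicClosure K)).map fun σ => (X - C σ) * C (aeval σ g)).esymm k) :
    ∃ r, IsGreatest {k | k ≤ d ∧ T k ≠ 0} r ∧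
      filterNe f g = (C (T r)⁻¹ * A r).map (algebraMap K (AlgebraicClosure K)) := by
  classical
  set s := f.aroots (AlgebraicClosure K)
  set s' := s.filter fun σ => aeval σ g ≠ 0 with hs'
  have hcard : Multiset.card s' ≤ d := hd ▸ Multiset.card_le_card (Multiset.filter_le _ _)
  have hT' : ∀ k ≤ d, algebraMap K (AlgebraicClosure K) (T k) =
      (s'.map fun σ => aeval σ g).esymm k := fun k hk => by
    rw [hT k hk]
    exact Multiset.esymm_map_filter _ _ _ (fun σ h => not_not.1 h) k
  have hprod : algebraMap K (AlgebraicClosure K) (T (Multiset.card s')) =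
      (s'.map fun σ => aeval σ g).prod := by
    rw [hT' _ hcard, ← Multiset.esymm_card, Multiset.card_map]
  have hne : algebraMap K (AlgebraicClosure K) (T (Multiset.card s')) ≠ 0 := by
    rw [hprod]
    refine Multiset.prod_ne_zero fun h => ?_
    obtain ⟨σ, hσ, h0⟩ := Multiset.mem_map.1 h
    exact (Multiset.mem_filter.1 hσ).2 h0
  -- The index r is the number, with multiplicity, of roots at which g does not vanish.
  refine ⟨Multiset.card s', ⟨⟨hcard, fun h => hne (by rw [h, map_zero])⟩, ?_⟩, ?_⟩
  · rintro k ⟨hk, hTk⟩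
    by_contra! hlt
    refine hTk ((algebraMap K (AlgebraicClosure K)).injective ?_)
    rw [hT' k hk, map_zero, Multiset.esymm_eq_zero_of_card_lt (by rwa [Multiset.card_map])]
  · have hAr : (A (Multiset.card s')).map (algebraMap K (AlgebraicClosure K)) =
        (s'.map fun σ => X - C σ).prod * C (s'.map fun σ => aeval σ g).prod := by
      rw [hA _ hcard, Multiset.esymm_map_filter _ (fun σ => aeval σ g ≠ 0) _ (fun σ h => by
        rw [not_not.1 h, C_0, mul_zero]), ← hs']
      conv_lhs => rw [← Multiset.card_map (fun σ => (X - C σ) * C (aeval σ g)) s']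
      rw [Multiset.esymm_card, Multiset.prod_map_mul, map_multiset_prod, Multiset.map_map]
      rfl
    rw [filterNe_eq_prod, Polynomial.map_mul, map_C, hAr, map_inv₀, mul_left_comm, ← C_mul,
      ← hprod, inv_mul_cancel₀ hne, C_1, mul_one]

theorem card_aroots_algebraicClosure {K : Type*} [Field K] (f : K[X]) :
    Multiset.card (f.aroots (AlgebraicClosure K)) = f.natDegree := by
  rw [aroots, ← (IsAlgClosed.splits _).natDegree_eq_card_roots, natDegree_map]

theorem algebraMap_resultant_eq_prod {K : Type*} [Field K] {f : K[X]} (hf : f.Monic) {G : K[X]}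
    {d : ℕ} (hG : G.natDegree ≤ d) :
    algebraMap K (AlgebraicClosure K) (f.resultant G f.natDegree d) =
      ((f.aroots (AlgebraicClosure K)).map fun σ => aeval σ G).prod := by
  have := resultant_eq_prod_eval (f.map (algebraMap K (AlgebraicClosure K)))
    (G.map (algebraMap K (AlgebraicClosure K))) d (natDegree_map_le.trans hG)
    (IsAlgClosed.splits _)
  rw [natDegree_map, resultant_map_map, (hf.map _).leadingCoeff, one_pow, one_mul] at this
  rw [this]
  congr 2
  funext σ
  rw [eval_map_algebraMap]

/-! ### Symmetric functions from resultants over fields with enough points. -/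

/-- Circuits of size at most `(d₁ + d₂ + 2) ^ e` and depth at most `Δ` for the elementary symmetric
functions of the `g(σ)` and for the coefficients of those of the `(y - σ) g(σ)`. -/
def HasEsymmCircuits (K : Type*) [Field K] (d₁ d₂ e Δ : ℕ) : Prop :=
  ∀ k ≤ d₁, ∃ (T : (Fin (d₁ + 1) ⊕ Fin (d₂ + 1) → K) → K)
    (A : ℕ → (Fin (d₁ + 1) ⊕ Fin (d₂ + 1) → K) → K),
    Computes (d₁ + d₂ + 2) e Δ T ∧ (∀ j, Computes (d₁ + d₂ + 2) e Δ (A j)) ∧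
    ∀ f g : K[X], f.Monic → f.natDegree = d₁ → g.Monic → g.natDegree = d₂ →
      algebraMap K (AlgebraicClosure K) (T (coeffVec d₁ d₂ f g)) =
        ((f.aroots (AlgebraicClosure K)).map fun σ => aeval σ g).esymm k ∧
      ∀ j ≤ d₁, algebraMap K (AlgebraicClosure K) (A j (coeffVec d₁ d₂ f g)) =
        (((f.aroots (AlgebraicClosure K)).map fun σ =>
          (X - C σ) * C (aeval σ g)).esymm k).coeff j

section Generic

variable {K : Type*} [Field K] {d₁ d₂ : ℕ}

/-- The monic polynomial of degree `d₁` with the given lower coefficients. -/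
noncomputable def monicOfVec (x : Fin (d₁ + 1) ⊕ Fin (d₂ + 1) → K) : K[X] :=
  X ^ d₁ + ∑ i : Fin d₁, C (x (Sum.inl i.castSucc)) * X ^ (i : ℕ)

/-- The second polynomial of a pair of coefficient vectors. -/
noncomputable def sndOfVec (x : Fin (d₁ + 1) ⊕ Fin (d₂ + 1) → K) : K[X] :=
  ∑ j : Fin (d₂ + 1), C (x (Sum.inr j)) * X ^ (j : ℕ)

/-- `Computes` concerns every input vector, so the leading input is ignored and replaced by 1: the
resultant circuit then always receives a monic polynomial. -/
theorem monic_monicOfVec (x : Fin (d₁ + 1) ⊕ Fin (d₂ + 1) → K) : (monicOfVec x).Monic :=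
  monic_X_pow_add (degree_sum_fin_lt _)

theorem natDegree_monicOfVec (x : Fin (d₁ + 1) ⊕ Fin (d₂ + 1) → K) :
    (monicOfVec x).natDegree = d₁ := by
  rw [monicOfVec, natDegree_add_eq_left_of_degree_lt, natDegree_X_pow]
  rw [degree_X_pow]
  exact degree_sum_fin_lt _

theorem natDegree_sndOfVec_le (x : Fin (d₁ + 1) ⊕ Fin (d₂ + 1) → K) :
    (sndOfVec x).natDegree ≤ d₂ :=
  natDegree_sum_le_of_forall_le _ _ fun j _ =>
    (natDegree_C_mul_X_pow_le _ _).trans (Nat.lt_succ_iff.1 j.2)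

theorem monicOfVec_coeffVec {f : K[X]} (hf : f.Monic) (hd : f.natDegree = d₁) (g : K[X]) :
    monicOfVec (coeffVec d₁ d₂ f g) = f := by
  conv_rhs => rw [hf.as_sum, hd, Finset.sum_range]
  rfl

theorem sndOfVec_coeffVec (f : K[X]) {g : K[X]} (hd : g.natDegree = d₂) :
    sndOfVec (coeffVec d₁ d₂ f g) = g := by
  conv_rhs => rw [g.as_sum_range_C_mul_X_pow, hd, Finset.sum_range]
  rfl

theorem computes_eval_monicOfVec (p : K) :
    Computes (d₁ + d₂ + 2) 9 3
      fun x : Fin (d₁ + 1) ⊕ Fin (d₂ + 1) → K => (monicOfVec x).eval p := by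
  have hb : 2 ≤ d₁ + d₂ + 2 := by omega
  refine ((Computes.add hb ((Computes.const (p ^ d₁)).mono (by omega) (Nat.zero_le 6)
    (Nat.zero_le 2)) ((Computes.sum hb (n := d₁) (a := 1) (by rw [pow_one]; omega) fun i =>
      Computes.const_mul hb (p ^ (i : ℕ)) (Computes.var (Sum.inl i.castSucc))))).mono
    (by omega) le_rfl le_rfl).congr fun x => ?_
  simp only [monicOfVec, eval_add, eval_pow, eval_X, eval_finsetSum, eval_mul, eval_C, mul_comm]

theorem computes_eval_sndOfVec (p : K) :
    Computes (d₁ + d₂ + 2) 6 2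
      fun x : Fin (d₁ + 1) ⊕ Fin (d₂ + 1) → K => (sndOfVec x).eval p := by
  have hb : 2 ≤ d₁ + d₂ + 2 := by omega
  refine (Computes.sum hb (n := d₂ + 1) (a := 1) (by rw [pow_one]; omega) fun i =>
    Computes.const_mul hb (p ^ (i : ℕ)) (Computes.var (Sum.inr i))).congr fun x => ?_
  simp only [sndOfVec, eval_pow, eval_X, eval_finsetSum, eval_mul, eval_C, mul_comm]

theorem computes_resultant {N M : ℕ} {a : Fin M → K}
    (ha : Function.Injective a) (hN : N = d₁ + d₂ + 2) (hM : M = (d₁ + 1) * (N + 1) ^ 2)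
    (q : K[X]) (hq : q.natDegree ≤ 1) :
    Computes (d₁ + d₂ + 2) 85 19 fun x : Fin (d₁ + 1) ⊕ Fin (d₂ + 1) → K =>
      (monicOfVec x).resultant (1 + q * sndOfVec x) d₁ (d₂ + 1) := by
  have hb : 2 ≤ d₁ + d₂ + 2 := by omega
  have hN1 : N + 1 ≤ N ^ 2 := by nlinarith
  -- `r = 5` because M ≤ N · (N²)² with N the base; 12 and 4 are the cost of evaluating `1 + q *
  -- sndOfVec x`, of degree at most d₂ + 1.
  refine (Computes.resultant (r := 5) (e := 12) (Δ := 4) (N := N) hb ha ?_ ?_ ?_ ?_ (by omega)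
    monic_monicOfVec natDegree_monicOfVec ?_ (fun p => (computes_eval_monicOfVec p).mono
    (by omega) (by omega) (by omega)) ?_).mono (by omega) (by omega) (by omega)
  · rw [hM, ← hN]
    calc (d₁ + 1) * (N + 1) ^ 2 ≤ N * (N ^ 2) ^ 2 :=
          Nat.mul_le_mul (by omega) (Nat.pow_le_pow_left hN1 2)
      _ = N ^ 5 := by ring
  · rw [← hN]
    exact Nat.le_self_pow (by omega) N
  · rw [hM]
    nlinarith
  · rw [hM]
    nlinarith
  · intro x
    refine (natDegree_add_le _ _).trans (max_le (by simp) ?_)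
    rw [add_comm d₂]
    exact natDegree_mul_le.trans (add_le_add hq (natDegree_sndOfVec_le x))
  · intro p
    refine ((Computes.add hb ((Computes.const 1).mono (by omega) (Nat.zero_le 9) (Nat.zero_le 3))
      (Computes.const_mul hb (q.eval p) (computes_eval_sndOfVec p))).mono
      (by omega) le_rfl le_rfl).congr fun x => ?_
    simp

theorem algebraMap_resultant_coeffVec {f g : K[X]} (hf : f.Monic) (hfd : f.natDegree = d₁)
    (hgd : g.natDegree = d₂) {q : K[X]} (hq : q.natDegree ≤ 1) :
    algebraMap K (AlgebraicClosure K) ((monicOfVec (coeffVec d₁ d₂ f g)).resultant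
        (1 + q * sndOfVec (coeffVec d₁ d₂ f g)) d₁ (d₂ + 1)) =
      ((f.aroots (AlgebraicClosure K)).map fun σ => 1 + aeval σ q * aeval σ g).prod := by
  rw [monicOfVec_coeffVec hf hfd, sndOfVec_coeffVec f hgd]
  subst hfd
  rw [algebraMap_resultant_eq_prod hf]
  · simp
  · refine (natDegree_add_le _ _).trans (max_le (by simp) ?_)
    rw [add_comm d₂]
    exact natDegree_mul_le.trans (add_le_add hq hgd.le)

theorem hasEsymmCircuits_of_injective {N M : ℕ} {a : Fin M → K}
    (ha : Function.Injective a) (hN : N = d₁ + d₂ + 2) (hM : M = (d₁ + 1) * (N + 1) ^ 2) :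
    HasEsymmCircuits K d₁ d₂ 105 23 := by
  intro k hk
  have hb : 2 ≤ d₁ + d₂ + 2 := by omega
  have hMb : M ≤ (d₁ + d₂ + 2) ^ 5 := by
    have hN1 : N + 1 ≤ N ^ 2 := by nlinarith
    rw [hM, ← hN]
    calc (d₁ + 1) * (N + 1) ^ 2 ≤ N * (N ^ 2) ^ 2 :=
          Nat.mul_le_mul (by omega) (Nat.pow_le_pow_left hN1 2)
      _ = N ^ 5 := by ring
  have hdM : d₁ < M := by rw [hM]; nlinarith
  have hq : ∀ u v : K, (C u * (C v - X)).natDegree ≤ 1 := fun u v =>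
    (natDegree_C_mul_le _ _).trans ((natDegree_sub_le _ _).trans (by simp))
  choose c hc using fun k => exists_coeff_functional ha k
  -- The outer sum extracts the coefficient of z^k from the values at z = `a l`; for `A` an inner
  -- sum extracts that of y^j from the values at y = `a l'`, where y - σ becomes the value at σ of
  -- `C (a l') - X`.
  refine ⟨fun x => ∑ l, c k l *
      (monicOfVec x).resultant (1 + C (a l) * sndOfVec x) d₁ (d₂ + 1),
    fun j x => ∑ l, c k l * ∑ l', c j l' *
      (monicOfVec x).resultant (1 + (C (a l) * (C (a l') - X)) * sndOfVec x) d₁ (d₂ + 1),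
    ?_, fun j => ?_, fun f g hf hfd hg hgd => ⟨?_, fun j hj => ?_⟩⟩
  · exact (Computes.sum hb hMb fun l => Computes.const_mul hb (c k l)
      (computes_resultant ha hN hM (C (a l)) (by simp))).mono (by omega) (by omega) (by omega)
  · exact (Computes.sum hb hMb fun l => Computes.const_mul hb (c k l) (Computes.sum hb hMb
      fun l' => Computes.const_mul hb (c j l') (computes_resultant ha hN hM
        _ (hq _ _)))).mono (by omega) (by omega) (by omega)
  · rw [← Multiset.coeff_prod_one_add_C_mul_X, hc k (AlgebraicClosure K), map_sum]
    · refine Finset.sum_congr rfl fun l _ => ?_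
      rw [map_mul, algebraMap_resultant_coeffVec hf hfd hgd (by simp), eval_multiset_prod,
        Multiset.map_map, Multiset.map_map]
      congr 3
      funext σ
      simp
      ring
    · refine lt_of_le_of_lt (Multiset.natDegree_prod_map_le _ _ fun x => ?_) ?_
      · refine (natDegree_add_le _ _).trans (max_le (by simp) ?_)
        exact (natDegree_C_mul_le _ _).trans natDegree_X_le
      · rwa [Multiset.card_map, card_aroots_algebraicClosure, hfd]
  · rw [← Multiset.coeff_prod_one_add_C_mul_X, hc k (AlgebraicClosure K)[X], map_sum,
      finsetSum_coeff]
    · refine Finset.sum_congr rfl fun l _ => ?_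
      rw [map_mul, Polynomial.algebraMap_apply, coeff_C_mul, eval_multiset_prod, Multiset.map_map,
        Multiset.map_map, hc j (AlgebraicClosure K), map_sum]
      · congr 1
        refine Finset.sum_congr rfl fun l' _ => ?_
        rw [map_mul, algebraMap_resultant_coeffVec hf hfd hgd (hq _ _), eval_multiset_prod,
          Multiset.map_map]
        congr 3
        funext σ
        simp
        ring
      · refine lt_of_le_of_lt (Multiset.natDegree_prod_map_le _ _ fun σ => ?_) ?_
        · simp only [Function.comp_apply, eval_add, eval_one, eval_mul, eval_C, eval_X,
            Polynomial.algebraMap_apply]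
          refine (natDegree_add_le _ _).trans (max_le (by simp) ?_)
          rw [mul_assoc, ← C_mul, mul_comm]
          exact (natDegree_C_mul_le _ _).trans (natDegree_X_sub_C_le _)
        · rwa [card_aroots_algebraicClosure, hfd]
    · refine lt_of_le_of_lt (Multiset.natDegree_prod_map_le _ _ fun x => ?_) ?_
      · refine (natDegree_add_le _ _).trans (max_le (by simp) ?_)
        exact (natDegree_C_mul_le _ _).trans natDegree_X_le
      · rwa [Multiset.card_map, card_aroots_algebraicClosure, hfd]

end Generic

theorem exists_injective_of_le_card {K : Type*} {M : ℕ} (h : (M : ℕ∞) ≤ ENat.card K) :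
    ∃ a : Fin M → K, Function.Injective a := by
  have h1 : (M : Cardinal) ≤ Cardinal.mk K := Cardinal.natCast_le_toENat.1 h
  obtain ⟨φ⟩ := Cardinal.lift_mk_le'.1
    (show Cardinal.lift (Cardinal.mk (Fin M)) ≤ Cardinal.lift.{0} (Cardinal.mk K) by simpa using h1)
  exact ⟨φ, φ.injective⟩

/-! ### Degrees with d₁ d₂ ≤ 1, where the cardinality bound gives too few nodes. -/

section SpecialCases

variable {K : Type*} [Field K]

theorem Computes.of_const {V : Type*} {b e Δ : ℕ} (hb : 0 < b) (a : K) :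
    Computes (V := V) b e Δ fun _ => a :=
  (Computes.const a).mono hb (Nat.zero_le _) (Nat.zero_le _)

theorem hasEsymmCircuits_zero_left (d₂ e Δ : ℕ) : HasEsymmCircuits K 0 d₂ e Δ := by
  intro k hk
  obtain rfl : k = 0 := Nat.le_zero.1 hk
  refine ⟨fun _ => 1, fun j _ => if j = 0 then 1 else 0, Computes.of_const (by omega) _,
    fun j => Computes.of_const (by omega) _, fun f g _ _ _ _ => ?_⟩
  simp [Multiset.esymm_zero_right, coeff_one, apply_ite]

/-- Both sides are a coefficient in Y of ∏ (Y + X - σ), the Taylor expansion at X of ∏ (Y - σ). For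
g = 1 this gives A_k as a Hasse derivative of f, with no interpolation. -/
theorem esymm_map_X_sub_C {L : Type*} [Field L] (s : Multiset L) {k : ℕ}
    (hk : k ≤ Multiset.card s) :
    (s.map fun σ => X - C σ).esymm k =
      hasseDeriv (Multiset.card s - k) (s.map fun σ => X - C σ).prod := by
  have h := Multiset.prod_X_add_C_coeff (s.map fun σ => (X - C σ : L[X]))
    (k := Multiset.card s - k) (by simp)
  rw [Multiset.card_map, Nat.sub_sub_self hk] at h
  rw [← h]
  have h2 : ((s.map fun σ => (X - C σ : L[X])).map fun r => (X + C r : L[X][X])).prod =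
      taylor X ((s.map fun σ => X - C σ).prod.map (C : L →+* L[X])) := by
    change _ = taylorAlgHom (X : L[X]) ((s.map fun σ => X - C σ).prod.map (C : L →+* L[X]))
    rw [Polynomial.map_multiset_prod, map_multiset_prod (taylorAlgHom (X : L[X])),
      Multiset.map_map, Multiset.map_map, Multiset.map_map]
    congr 2
    funext σ
    simp [taylor_X]
    ring
  rw [h2, taylor_coeff]
  generalize (s.map fun σ => (X - C σ : L[X])).prod = p
  have h3 : hasseDeriv (Multiset.card s - k) (p.map (C : L →+* L[X])) =
      (hasseDeriv (Multiset.card s - k) p).map C := by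
    ext i : 1
    simp [hasseDeriv_coeff]
  rw [h3, eval_map, eval₂_C_X]

theorem esymm_map_one {R ι : Type*} [CommRing R] (s : Multiset ι) (k : ℕ) :
    (s.map fun _ => (1 : R)).esymm k = (Multiset.card s).choose k := by
  rw [← Multiset.coeff_prod_one_add_C_mul_X, Multiset.map_map, ← coeff_one_add_X_pow]
  simp

theorem hasEsymmCircuits_zero_right (d₁ : ℕ) : HasEsymmCircuits K d₁ 0 3 1 := by
  intro k hk
  refine ⟨fun _ => d₁.choose k, fun j x => ((j + (d₁ - k)).choose (d₁ - k) : K) *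
    (if h : j + (d₁ - k) < d₁ + 1 then x (Sum.inl ⟨j + (d₁ - k), h⟩) else 0),
    Computes.of_const (by omega) _, fun j => ?_, fun f g hf hfd hg hgd => ?_⟩
  · refine Computes.const_mul (e := 0) (Δ := 0) (by omega) _ ?_
    split_ifs
    · exact Computes.var _
    · exact Computes.const 0
  · obtain rfl : g = 1 := eq_one_of_monic_natDegree_zero hg hgd
    have hc := card_aroots_algebraicClosure f
    rw [hfd] at hc
    have hprod : ((f.aroots (AlgebraicClosure K)).map fun σ => X - C σ).prod =
        f.map (algebraMap K (AlgebraicClosure K)) :=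
      ((IsAlgClosed.splits _).eq_prod_roots_of_monic (hf.map _)).symm
    refine ⟨?_, fun j _ => ?_⟩
    · simp only [map_one, map_natCast, esymm_map_one, hc]
    · simp only [map_one, mul_one]
      rw [esymm_map_X_sub_C _ (hc.symm ▸ hk), hc, hprod, hasseDeriv_coeff, coeff_map]
      split_ifs with h
      · simp [coeffVec]
      · rw [coeff_eq_zero_of_natDegree_lt (by omega)]
        simp

theorem esymm_singleton_one {R : Type*} [CommRing R] (a : R) :
    ({a} : Multiset R).esymm 1 = a := by
  simp [Multiset.esymm, Multiset.powersetCard_one]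

theorem hasEsymmCircuits_one_one : HasEsymmCircuits K 1 1 9 3 := by
  intro k hk
  have hs : Computes (1 + 1 + 2) 6 2 fun x : Fin (1 + 1) ⊕ Fin (1 + 1) → K =>
      x (Sum.inr 0) + -1 * x (Sum.inl 0) :=
    Computes.add (by omega) ((Computes.var _).mono (by omega) (Nat.zero_le 3) (Nat.zero_le 1))
      (Computes.const_mul (by omega) _ (Computes.var _))
  refine ⟨fun x => if k = 0 then 1 else x (Sum.inr 0) + -1 * x (Sum.inl 0),
    fun j x => if k = 0 then (if j = 0 then 1 else 0) else
      (if j = 0 then x (Sum.inl 0) else 1) * (x (Sum.inr 0) + -1 * x (Sum.inl 0)), ?_, fun j => ?_,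
      fun f g hf hfd hg hgd => ?_⟩
  · split_ifs
    · exact Computes.of_const (by omega) _
    · exact hs.mono (by omega) (by omega) (by omega)
  · by_cases hk0 : k = 0
    · simp only [hk0, if_true]
      exact Computes.of_const (by omega) _
    · simp only [hk0, if_false]
      refine Computes.mul (by omega) ?_ hs
      split_ifs
      · exact (Computes.var _).mono (by omega) (by omega) (by omega)
      · exact Computes.of_const (by omega) _
  · have hf' : f = X + C (f.coeff 0) := by
      conv_lhs => rw [hf.as_sum, hfd]
      simp
    have hg' : g = X + C (g.coeff 0) := by
      conv_lhs => rw [hg.as_sum, hgd]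
      simp
    have hr : f.aroots (AlgebraicClosure K) =
        {-algebraMap K (AlgebraicClosure K) (f.coeff 0)} := by
      conv_lhs => rw [hf', aroots, Polynomial.map_add, map_X, map_C]
      exact roots_X_add_C _
    have hv : aeval (-algebraMap K (AlgebraicClosure K) (f.coeff 0)) g =
        algebraMap K (AlgebraicClosure K) (g.coeff 0 - f.coeff 0) := by
      conv_lhs => rw [hg']
      simp
      ring
    rw [hr, Multiset.map_singleton, Multiset.map_singleton, hv]
    obtain rfl | rfl : k = 0 ∨ k = 1 := by omega
    · simp [Multiset.esymm_zero_right, coeff_one, apply_ite]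
    · refine ⟨?_, fun j hj => ?_⟩
      · simp [esymm_singleton_one, coeffVec]
        ring
      · rw [esymm_singleton_one, coeff_mul_C]
        obtain rfl | rfl : j = 0 ∨ j = 1 := by omega
        · simp [coeffVec, sub_eq_add_neg]
        · simp [coeffVec, sub_eq_add_neg]

end SpecialCases

/-! ### Cardinality bound and conclusion. -/

theorem HasEsymmCircuits.mono {K : Type*} [Field K] {d₁ d₂ e Δ e' Δ' : ℕ}
    (h : HasEsymmCircuits K d₁ d₂ e Δ) (he : e ≤ e') (hΔ : Δ ≤ Δ') :
    HasEsymmCircuits K d₁ d₂ e' Δ' := by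
  intro k hk
  obtain ⟨T, A, h1, h2, h3⟩ := h k hk
  exact ⟨T, A, h1.mono (by omega) he hΔ, fun j => (h2 j).mono (by omega) he hΔ, h3⟩

/-- With s = d₁ d₂ ≥ 2 the factors are at most s² and (s³)², whence the exponent 8. -/
theorem card_points_le_pow {d₁ d₂ : ℕ} (h1 : d₁ ≠ 0) (h2 : d₂ ≠ 0) (h : d₁ * d₂ ≠ 1) :
    (d₁ + 1) * (d₁ + d₂ + 2 + 1) ^ 2 ≤ (d₁ * d₂) ^ 8 := by
  have h1' : 1 ≤ d₁ := Nat.one_le_iff_ne_zero.2 h1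
  have h2' : 1 ≤ d₂ := Nat.one_le_iff_ne_zero.2 h2
  have hs : d₁ + d₂ ≤ d₁ * d₂ + 1 := by nlinarith
  have hd : d₁ ≤ d₁ * d₂ := Nat.le_mul_of_pos_right _ h2'
  have hp : 1 ≤ d₁ * d₂ := Nat.mul_pos h1' h2'
  generalize d₁ * d₂ = s at *
  have hs2 : 2 ≤ s := by omega
  have e1 : d₁ + 1 ≤ s ^ 2 := by nlinarith
  have e2 : d₁ + d₂ + 2 + 1 ≤ s ^ 3 := by
    have : 4 ≤ s ^ 2 := by nlinarith
    have : 4 * s ≤ s ^ 3 := by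
      rw [pow_succ]
      exact Nat.mul_le_mul_right _ this
    omega
  calc (d₁ + 1) * (d₁ + d₂ + 2 + 1) ^ 2 ≤ s ^ 2 * (s ^ 3) ^ 2 :=
        Nat.mul_le_mul e1 (Nat.pow_le_pow_left e2 2)
    _ = s ^ 8 := by ring

theorem hasEsymmCircuits_of_le_card {K : Type*} [Field K] {d₁ d₂ : ℕ}
    (h : (((d₁ * d₂) ^ 8 : ℕ) : ℕ∞) ≤ ENat.card K) : HasEsymmCircuits K d₁ d₂ 105 23 := by
  by_cases h1 : d₁ = 0
  · subst h1
    exact hasEsymmCircuits_zero_left _ _ _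
  by_cases h2 : d₂ = 0
  · subst h2
    exact (hasEsymmCircuits_zero_right _).mono (by omega) (by omega)
  by_cases h3 : d₁ * d₂ = 1
  · obtain ⟨rfl, rfl⟩ := mul_eq_one.1 h3
    exact hasEsymmCircuits_one_one.mono (by omega) (by omega)
  obtain ⟨a, ha⟩ := exists_injective_of_le_card
    ((Nat.cast_le.2 (card_points_le_pow h1 h2 h3)).trans h)
  exact hasEsymmCircuits_of_injective ha rfl rfl

theorem coeff_polyOfVec {R : Type*} [Semiring R] {m : ℕ} (a : Fin m → R) (j : ℕ) :
    (polyOfVec a).coeff j = if h : j < m then a ⟨j, h⟩ else 0 := by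
  simp only [polyOfVec, finsetSum_coeff, coeff_C_mul, coeff_X_pow]
  split_ifs with h
  · rw [Finset.sum_eq_single ⟨j, h⟩]
    · simp
    · intro i _ hi
      rw [if_neg fun hj => hi (Fin.ext hj.symm), mul_zero]
    · simp
  · refine Finset.sum_eq_zero fun i _ => ?_
    rw [if_neg (by omega), mul_zero]

theorem mainTheorem6 :
    ∃ c e Δ : ℕ, ∀ (K : Type*) [Field K] (d₁ d₂ : ℕ),
      (((d₁ * d₂) ^ c : ℕ) : ℕ∞) ≤ ENat.card K →
      ∃ (A : ℕ → AlgCircuit K (Fin (d₁ + 1) ⊕ Fin (d₂ + 1)) (d₁ + 1))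
        (B T : ℕ → AlgCircuit K (Fin (d₁ + 1) ⊕ Fin (d₂ + 1)) 1),
        -- polynomial size and constant depth
        (∀ k ≤ d₁,
          ((A k).size ≤ (d₁ + d₂ + 2) ^ e ∧ (A k).depth ≤ Δ) ∧
          ((B k).size ≤ (d₁ + d₂ + 2) ^ e ∧ (B k).depth ≤ Δ) ∧
          ((T k).size ≤ (d₁ + d₂ + 2) ^ e ∧ (T k).depth ≤ Δ)) ∧
        ∀ f g : Polynomial K, f.Monic → f.natDegree = d₁ → g.Monic → g.natDegree = d₂ →
          -- what the circuits compute
          (∀ k ≤ d₁,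
            algebraMap K (AlgebraicClosure K) ((T k).eval (coeffVec d₁ d₂ f g) 0) =
              ((f.aroots (AlgebraicClosure K)).map fun σ => Polynomial.aeval σ g).esymm k ∧
            (B k).eval (coeffVec d₁ d₂ f g) 0 = (T k).eval (coeffVec d₁ d₂ f g) 0 ∧
            (polyOfVec ((A k).eval (coeffVec d₁ d₂ f g))).map
                (algebraMap K (AlgebraicClosure K)) =
              ((f.aroots (AlgebraicClosure K)).map fun σ =>
                (Polynomial.X - Polynomial.C σ) *
                  Polynomial.C (Polynomial.aeval σ g)).esymm k) ∧
          -- the filter is the ratio selected by the tests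
          ∃ r, IsGreatest {k | k ≤ d₁ ∧ (T k).eval (coeffVec d₁ d₂ f g) 0 ≠ 0} r ∧
            (B r).eval (coeffVec d₁ d₂ f g) 0 ≠ 0 ∧
            filterNe f g =
              (Polynomial.C ((B r).eval (coeffVec d₁ d₂ f g) 0)⁻¹ *
                polyOfVec ((A r).eval (coeffVec d₁ d₂ f g))).map
                (algebraMap K (AlgebraicClosure K)) := by
  refine ⟨8, 106, 23, fun K _ d₁ d₂ hcard => ?_⟩
  have key : ∀ k : Fin (d₁ + 1), ∃ (T : AlgCircuit K (Fin (d₁ + 1) ⊕ Fin (d₂ + 1)) 1)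
      (A : AlgCircuit K (Fin (d₁ + 1) ⊕ Fin (d₂ + 1)) (d₁ + 1)),
      (A.size ≤ (d₁ + d₂ + 2) ^ 106 ∧ A.depth ≤ 23) ∧
      (T.size ≤ (d₁ + d₂ + 2) ^ 106 ∧ T.depth ≤ 23) ∧
      ∀ f g : K[X], f.Monic → f.natDegree = d₁ → g.Monic → g.natDegree = d₂ →
        algebraMap K (AlgebraicClosure K) (T.eval (coeffVec d₁ d₂ f g) 0) =
          ((f.aroots (AlgebraicClosure K)).map fun σ => aeval σ g).esymm k ∧
        (polyOfVec (A.eval (coeffVec d₁ d₂ f g))).map (algebraMap K (AlgebraicClosure K)) =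
          ((f.aroots (AlgebraicClosure K)).map fun σ => (X - C σ) * C (aeval σ g)).esymm k := by
    intro k
    obtain ⟨T, A, ⟨T', hTs, hTd, hT⟩, hA, hspec⟩ :=
      hasEsymmCircuits_of_le_card hcard k (Nat.lt_succ_iff.1 k.2)
    obtain ⟨A', hAs, hAd, hA'⟩ := Computes.exists_parallel
      (F := fun j : Fin (d₁ + 1) => A j) fun j => hA j
    -- Juxtaposing the circuits of the d₁ + 1 coefficients costs one more power of the base.
    have hpow : (d₁ + 1) * (d₁ + d₂ + 2) ^ 105 ≤ (d₁ + d₂ + 2) ^ 106 := by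
      rw [pow_succ' _ 105]
      exact Nat.mul_le_mul_right _ (by omega)
    refine ⟨T', A', ⟨hAs.trans hpow, hAd⟩,
      ⟨hTs.trans (Nat.pow_le_pow_right (by omega) (by omega)), hTd⟩,
      fun f g hf hfd hg hgd => ?_⟩
    obtain ⟨h1, h2⟩ := hspec f g hf hfd hg hgd
    refine ⟨by rw [hT, h1], ?_⟩
    ext j
    rw [coeff_map, coeff_polyOfVec]
    split_ifs with hj
    · rw [hA', h2 j (Nat.lt_succ_iff.1 hj)]
    -- The k-th symmetric function of polynomials of degree at most 1 has degree at most k ≤ d₁, so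
    -- d₁ + 1 outputs hold it entirely.
    · rw [map_zero, coeff_eq_zero_of_natDegree_lt]
      refine lt_of_le_of_lt (Multiset.natDegree_esymm_le (fun p hp => ?_) _)
        (k.2.trans_le (not_lt.1 hj))
      obtain ⟨σ, -, rfl⟩ := Multiset.mem_map.1 hp
      rw [mul_comm]
      exact (natDegree_C_mul_le _ _).trans (natDegree_X_sub_C_le _)
  choose T A hAs hTs hspec using key
  -- The families are indexed by ℕ through reduction mod d₁ + 1, which is the identity in the
  -- relevant range.
  have hk : ∀ k ≤ d₁, ((Fin.ofNat (d₁ + 1) k : Fin (d₁ + 1)) : ℕ) = k := fun k hk =>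
    Nat.mod_eq_of_lt (Nat.lt_succ_iff.2 hk)
  refine ⟨fun k => A (Fin.ofNat _ k), fun k => T (Fin.ofNat _ k), fun k => T (Fin.ofNat _ k),
    fun k _ => ⟨hAs _, hTs _, hTs _⟩, fun f g hf hfd hg hgd => ?_⟩
  have hT := fun k (h : k ≤ d₁) => (hspec (Fin.ofNat _ k) f g hf hfd hg hgd).1
  have hA := fun k (h : k ≤ d₁) => (hspec (Fin.ofNat _ k) f g hf hfd hg hgd).2
  have hT' := fun k (h : k ≤ d₁) => (hT k h).trans (by rw [hk k h])
  have hA' := fun k (h : k ≤ d₁) => (hA k h).trans (by rw [hk k h])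
  refine ⟨fun k h => ⟨hT' k h, rfl, hA' k h⟩, ?_⟩
  obtain ⟨r, hr, hfilter⟩ := exists_isGreatest_filterNe
    (T := fun k => (T (Fin.ofNat _ k)).eval (coeffVec d₁ d₂ f g) 0)
    (A := fun k => polyOfVec ((A (Fin.ofNat _ k)).eval (coeffVec d₁ d₂ f g)))
    ((card_aroots_algebraicClosure f).trans hfd) hT' hA'
  exact ⟨r, hr, hr.1.2, hfilter⟩
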